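/- A deterministic one-tape Turing machine (DTM) has a finite state set $Q$, a finite working alphabet $\Gamma$ containing the input alphabet and a blank symbol that it never writes, and a partial transition function $\delta:Q\times\Gamma\to Q\times\Gamma\times\{\text{left},\text{right}\}$; it halts when no transition applies, and accepts if it then is in a final state. It is end-marked if every input $w$ is given as $\vdash w\dashv$ (the head starting on $\vdash$), where the endmarkers $\vdash,\dashv\in\Gamma$ are never overwritten and the head always moves right from $\vdash$ and left from $\dashv$. A Hennie machine is an end-marked DTM for which there are constants $K,C$ such that it halts within $K|w|+C$ steps on every input $w$. The size of a device is the length of its description in bits (its transition table, and its initial and final states), which is of order $|Q||\Gamma|\log(|Q||\Gamma|)$ for DTMs, $|\Sigma||Q|^2$ for nondeterministic finite automata (NFAs) and $|\Sigma||Q|\log|Q|$ for deterministic finite automata (DFAs, with a possibly partial transition function), where $\Sigma$ is the input alphabet. For $n>0$, an $n$-state busy beaver is an $n$-state deterministic Turing machine (with a partial transition function, and halting when no transition applies) with tape symbols blank and $1$, both of which it may write, on a tape infinite to the right only, which, started on the leftmost cell of the blank tape, halts with the maximum number of $1$s among all such $n$-state machines that halt. (Trying to leave the tape over its left end does not count as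 halting.) Its space is the number of cells that its head visits. Theorem. There is no recursive function $f:\mathbb N\to\mathbb N$ such that every Hennie machine of size $s$ has an equivalent NFA of size at most $f(s)$, and there is none such that every Hennie machine of size $s$ has an equivalent DFA of size at most $f(s)$. Moreover, this is witnessed by singleton unary languages of busy-beaver length: an $n$-state busy beaver exists for every $n>0$, and there are constants $C,D$ and, for each $n>0$ and each $n$-state busy beaver $B$, a Hennie machine $H_B$ with at most $Cn$ states and at most $D$ working symbols that accepts exactly $\{a^{m}\}$, where $m$ is the space of $B$, such that for every recursive function $f:\mathbb N\to\mathbb N$ there is an $n>0$ such that, for every $n$-state busy beaver $B$, each NFA (hence each DFA) accepting the language of $H_B$ has more than $f(\operatorname{size}(H_B))$ states. -/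

import Mathlib

namespace HennieTradeoff

open Turing (Dir)

/-! ### Deterministic one-tape Turing machines -/

/-- A deterministic one-tape Turing machine with input alphabet `A`: the working alphabet contains
the input symbols (through `inp`) and a blank which is not an input symbol and is never written;
the transition function is partial (`none` is undefined) and every transition moves the head. -/
structure DTM (A : Type) where
  Q : Type
  Γ : Type
  finQ : Finite Q
  finΓ : Finite Γ
  inp : A ↪ Γ
  blank : Γ
  inp_ne_blank : ∀ a, inp a ≠ blank
  δ : Q → Γ → Option (Q × Γ × Dir)
  not_write_blank : ∀ p s q t d, δ p s = some (q, t, d) → t ≠ blank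
  q₀ : Q
  F : Set Q

/-- A configuration: state, head position and contents of a bi-infinite tape. -/
structure Config (Q Γ : Type) where
  state : Q
  head : ℤ
  tape : ℤ → Γ

/-- The displacement of the head. -/
def shift : Dir → ℤ
  | Dir.left => -1
  | Dir.right => 1

/-- Iterating a partial step function exactly `t` times (`none` if this is not possible). -/
def runFor {X : Type} (step : X → Option X) : ℕ → X → Option X
  | 0, c => some c
  | t + 1, c => (runFor step t c).bind step

namespace DTM

variable {A : Type}

/-- One step; `none` exactly when no transition applies, i.e. when the machine halts. -/
def step (M : DTM A) (c : Config M.Q M.Γ) : Option (Config M.Q M.Γ) :=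
  (M.δ c.state (c.tape c.head)).map fun r =>
    { state := r.1
      head := c.head + shift r.2.2
      tape := Function.update c.tape c.head r.2.1 }

/-- The number of bits of a description of the machine by its transition table, with fixed-width
entries (an entry is "undefined" or a triple state, symbol, direction), one flag per state for
being final, and the index of the initial state. -/
noncomputable def size (M : DTM A) : ℕ :=
  Nat.card M.Q * Nat.card M.Γ * Nat.clog 2 (2 * (Nat.card M.Q * Nat.card M.Γ) + 1)
    + Nat.card M.Q + Nat.clog 2 (Nat.card M.Q)

end DTM

/-- End-marked machines: two distinct special working symbols that are never overwritten, and at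
which the head has to go back inside. -/
structure EndMarkedDTM (A : Type) extends DTM A where
  lend : Γ
  rend : Γ
  lend_ne_rend : lend ≠ rend
  lend_ne_blank : lend ≠ blank
  rend_ne_blank : rend ≠ blank
  inp_ne_lend : ∀ a, inp a ≠ lend
  inp_ne_rend : ∀ a, inp a ≠ rend
  δ_lend : ∀ p q t d, δ p lend = some (q, t, d) → t = lend ∧ d = Dir.right
  δ_rend : ∀ p q t d, δ p rend = some (q, t, d) → t = rend ∧ d = Dir.left

namespace EndMarkedDTM

variable {A : Type}

/-- The tape `lend w rend`, with `lend` in cell `0`, surrounded by blanks. -/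
def initTape (M : EndMarkedDTM A) (w : List A) (i : ℤ) : M.Γ :=
  if i < 0 then M.blank
  else (M.lend :: (w.map M.inp ++ [M.rend])).getD i.toNat M.blank

/-- The initial configuration on `w`: the head scans the left endmarker. -/
def init (M : EndMarkedDTM A) (w : List A) : Config M.Q M.Γ :=
  { state := M.q₀, head := 0, tape := M.initTape w }

/-- The accepted language: the inputs on which the machine halts in a final state. -/
def language (M : EndMarkedDTM A) : Language A :=
  {w | ∃ t c, runFor M.step t (M.init w) = some c ∧ M.step c = none ∧ c.state ∈ M.F}

/-- Hennie machines: the end-marked machines that halt, on each input, in linearly many steps. -/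
def IsHennie (M : EndMarkedDTM A) : Prop :=
  ∃ K C : ℕ, ∀ w : List A, ∃ t ≤ K * w.length + C, ∃ c,
    runFor M.step t (M.init w) = some c ∧ M.step c = none

end EndMarkedDTM

/-! ### Finite automata -/

/-- Deterministic automata: one initial state and at most one transition for each state and
symbol (so the transition function may be partial). -/
def IsDeterministic {A S : Type} (N : NFA A S) : Prop :=
  (∃ q, N.start = {q}) ∧ ∀ q a, (N.step q a).Subsingleton

/-- Bits of a description of an NFA: the transition matrix, and for each state one flag for being
initial and one for being final. -/
noncomputable def nfaSize {A S : Type} (_N : NFA A S) : ℕ :=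
  Nat.card A * Nat.card S ^ 2 + 2 * Nat.card S

/-- Bits of a description of a DFA: the table of the partial transition function, one flag per state
for being final, and the index of the initial state. -/
noncomputable def dfaSize {A S : Type} (_N : NFA A S) : ℕ :=
  Nat.card A * Nat.card S * Nat.clog 2 (Nat.card S + 1) + Nat.card S + Nat.clog 2 (Nat.card S)

/-! ### Busy beavers on a one-way infinite tape -/

/-- An `n`-state deterministic Turing machine with two tape symbols, `false` (the blank) and `true`
(the symbol `1`), both of which can be written. -/
structure BBMachine (n : ℕ) where
  start : Fin n
  δ : Fin n → Bool → Option (Fin n × Bool × Dir)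

/-- A configuration on a tape that is infinite to the right only. -/
structure BBConfig (n : ℕ) where
  state : Fin n
  head : ℕ
  tape : ℕ → Bool

namespace BBMachine

variable {n : ℕ}

/-- One step; there is no next configuration if no transition applies, or if the head would leave
the tape over its left end. -/
def step (B : BBMachine n) (c : BBConfig n) : Option (BBConfig n) :=
  match B.δ c.state (c.tape c.head) with
  | none => none
  | some (q, b, Dir.right) => some ⟨q, c.head + 1, Function.update c.tape c.head b⟩
  | some (q, b, Dir.left) =>
      if c.head = 0 then none else some ⟨q, c.head - 1, Function.update c.tape c.head b⟩

/-- The start on the leftmost cell of the blank tape. -/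
def init (B : BBMachine n) : BBConfig n := ⟨B.start, 0, fun _ => false⟩

/-- The machine, started on the blank tape, halts (no transition applies; leaving the tape over its
left end is not halting) with exactly `k` cells containing a `1`. -/
def HaltsWithOnes (B : BBMachine n) (k : ℕ) : Prop :=
  ∃ t c, runFor B.step t B.init = some c ∧ B.δ c.state (c.tape c.head) = none ∧
    {i | c.tape i = true}.ncard = k

/-- An `n`-state busy beaver: it halts with the maximum number of `1`s among all the `n`-state
machines that halt. -/
def IsBusyBeaver (B : BBMachine n) : Prop :=
  ∃ k, B.HaltsWithOnes k ∧ ∀ (B' : BBMachine n) (k' : ℕ), B'.HaltsWithOnes k' → k' ≤ k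

/-- The space used from the blank tape: the number of cells visited by the head. -/
noncomputable def space (B : BBMachine n) : ℕ :=
  {i | ∃ t c, runFor B.step t B.init = some c ∧ c.head = i}.ncard

end BBMachine

end HennieTradeoff

/-! Busy beavers outgrow every computable function, yet a Hennie machine with linearly many states
can recognise the unary word whose length is the space `m` of a given `n`-state busy beaver `B`. It
runs `B` on the input cells and accepts if `B` visits exactly these cells
(`exists_halting_simConfig`). For a fixed `B` the halting time is a constant, and only a final sweep
grows with the input, so the time is linear. An NFA with `q` states for this one word satisfies `m <
2 ^ q` by pumping (`lt_two_pow_card_of_accepts_singleton`), so a recursive bound on `q` in terms of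
the machine size would bound `m` recursively.

What remains is the growth of `m`. It is at least the number of ones left by `B`
(`BBMachine.HaltsWithOnes.le_space`), and for each computable `g` there are constants `a`, `c` such
that some halting machine with at most `a * x + c` states leaves at least `g x` ones
(`exists_haltsWithOnes_of_computable`). To see this, `g` is turned into a while program
(`computes_of_partrec'`), and the program into a two-symbol machine on a one-way tape
(`Frag.exists_implements`) that holds the registers in unary on interleaved tracks. The argument `x`
is supplied by `x` increment fragments of constant size. Choosing `g` fast enough in terms of `f`,
and then `x` large compared with `a` and `c`, defeats the bound `f`
(`exists_lt_card_of_computable`). -/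

namespace HennieTradeoff

open Turing (Dir)

/-! ### Iterating partial step functions -/

section Runs

variable {X : Type} {step : X → Option X}

theorem runFor_add (s t : ℕ) (c : X) :
    runFor step (s + t) c = (runFor step s c).bind (runFor step t) := by
  induction t with
  | zero => cases runFor step s c <;> simp [runFor]
  | succ t ih =>
    rw [← Nat.add_assoc, runFor, ih, Option.bind_assoc]
    rfl

theorem runFor_one (c : X) : runFor step 1 c = step c := by
  simp [runFor]

theorem runFor_trans {s t : ℕ} {c d e : X} (h : runFor step s c = some d)
    (h' : runFor step t d = some e) : runFor step (s + t) c = some e := by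
  rw [runFor_add, h]
  exact h'

theorem runFor_le_of_halt {s t : ℕ} {c d e : X} (h : runFor step s c = some d)
    (hd : step d = none) (h' : runFor step t c = some e) : t ≤ s := by
  by_contra hlt
  obtain ⟨r, rfl⟩ : ∃ r, t = s + (1 + r) := ⟨t - s - 1, by omega⟩
  rw [runFor_add, h, Option.bind_some, runFor_add, runFor_one, hd] at h'
  simp at h'

theorem halt_unique {s t : ℕ} {c d e : X} (h : runFor step s c = some d) (hd : step d = none)
    (h' : runFor step t c = some e) (he : step e = none) : d = e := by
  have := le_antisymm (runFor_le_of_halt h hd h') (runFor_le_of_halt h' he h)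
  subst this
  simpa [h] using h'

theorem runFor_prefix {s t : ℕ} {c d : X} (h : runFor step t c = some d) (hs : s ≤ t) :
    ∃ e, runFor step s c = some e := by
  obtain ⟨r, rfl⟩ := Nat.exists_eq_add_of_le hs
  rw [runFor_add] at h
  cases h' : runFor step s c with
  | none => simp [h'] at h
  | some e => exact ⟨e, rfl⟩

theorem exists_runFor_of_reflTransGen {c d : X}
    (h : Relation.ReflTransGen (fun a b => step a = some b) c d) :
    ∃ t, runFor step t c = some d := by
  induction h with
  | refl => exact ⟨0, rfl⟩
  | tail _ h ih =>
    obtain ⟨t, ht⟩ := ih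
    exact ⟨t + 1, by simp [runFor, ht, h]⟩

end Runs

/-! ### Busy beavers -/

instance : Finite Dir :=
  Finite.of_injective (fun d : Dir => decide (d = Dir.left)) (by
    intro a b h
    cases a <;> cases b <;> simp at h ⊢)

instance (n : ℕ) : Finite (BBMachine n) :=
  Finite.of_injective (fun B : BBMachine n => (B.start, B.δ)) (by
    rintro ⟨s, d⟩ ⟨s', d'⟩ h
    simpa using h)

namespace BBMachine

variable {n : ℕ} {B : BBMachine n}

theorem step_eq_none_of_δ {c : BBConfig n} (h : B.δ c.state (c.tape c.head) = none) :
    B.step c = none := by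
  simp [step, h]

theorem HaltsWithOnes.unique {k k' : ℕ} (h : B.HaltsWithOnes k) (h' : B.HaltsWithOnes k') :
    k = k' := by
  obtain ⟨t, c, hr, hc, rfl⟩ := h
  obtain ⟨t', c', hr', hc', rfl⟩ := h'
  rw [halt_unique hr (step_eq_none_of_δ hc) hr' (step_eq_none_of_δ hc')]

/-- There are finitely many `n`-state machines and each has at most one score. The set of scores is
nonempty because the machine without transitions halts at once. -/
theorem exists_isBusyBeaver (hn : 0 < n) : ∃ B : BBMachine n, B.IsBusyBeaver := by
  classical
  let S : Set ℕ := {k | ∃ B : BBMachine n, B.HaltsWithOnes k}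
  have hne : S.Nonempty := by
    refine ⟨0, ⟨⟨⟨0, hn⟩, fun _ _ => none⟩, 0, _, rfl, rfl, ?_⟩⟩
    simp [init]
  have hfin : S.Finite := by
    have : S = ⋃ B : BBMachine n, {k | B.HaltsWithOnes k} := by
      ext k
      simp [S]
    rw [this]
    exact Set.finite_iUnion fun B => Set.Subsingleton.finite fun _ h _ h' => h.unique h'
  obtain ⟨k, ⟨B, hB⟩, hmax⟩ := hfin.exists_maximal hne
  refine ⟨B, k, hB, fun B' k' h' => ?_⟩
  by_contra hlt
  exact hlt (hmax ⟨B', h'⟩ (by omega))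

/-- After `t` steps exactly the first `v` cells have been left at least once, the head is on one of
them or on the next cell, and all other cells are blank. -/
structure Visited (B : BBMachine n) (t : ℕ) (c : BBConfig n) (v : ℕ) : Prop where
  head_le : c.head ≤ v
  blank : ∀ i, v ≤ i → c.tape i = false
  mem_iff : ∀ i, (∃ s < t, ∃ d, runFor B.step s B.init = some d ∧ d.head = i) ↔ i < v

theorem Visited.zero : B.Visited 0 B.init 0 :=
  ⟨le_rfl, fun _ _ => rfl, by simp⟩

/-- The possible steps of the machine. -/
theorem step_eq_some {c d : BBConfig n} (h : B.step c = some d) :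
    ∃ q b D, B.δ c.state (c.tape c.head) = some (q, b, D) ∧ d.state = q ∧
      d.tape = Function.update c.tape c.head b ∧ (d.head : ℤ) = c.head + shift D := by
  unfold step at h
  rcases hδ : B.δ c.state (c.tape c.head) with _ | ⟨q, b, D⟩
  · simp [hδ] at h
  · rw [hδ] at h
    refine ⟨q, b, D, rfl, ?_⟩
    cases D with
    | right =>
      simp only [Option.some.injEq] at h
      subst h
      simp [shift]
    | left =>
      by_cases h0 : c.head = 0
      · simp [h0] at h
      · simp only [h0, if_false, Option.some.injEq] at h
        subst h
        simp only [shift, true_and]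
        omega

/-- The head moves by one cell at a time, so the cells it has left always form an initial segment,
which grows only when the head leaves the cell `v`. -/
theorem Visited.succ {t v : ℕ} {c d : BBConfig n} (h : B.Visited t c v)
    (hc : runFor B.step t B.init = some c) (hd : B.step c = some d) :
    B.Visited (t + 1) d (max v (c.head + 1)) := by
  obtain ⟨q, b, D, -, -, htape, hhead⟩ := step_eq_some hd
  have := h.head_le
  refine ⟨?_, ?_, ?_⟩
  · cases D <;> simp only [shift] at hhead <;> omega
  · intro i hi
    rw [htape, Function.update_of_ne (by omega)]
    exact h.blank i (by omega)
  · intro i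
    have key : (∃ s < t + 1, ∃ d, runFor B.step s B.init = some d ∧ d.head = i) ↔
        (∃ s < t, ∃ d, runFor B.step s B.init = some d ∧ d.head = i) ∨ c.head = i := by
      constructor
      · rintro ⟨s, hs, e, he, rfl⟩
        rcases Nat.lt_succ_iff_lt_or_eq.1 hs with hs | rfl
        · exact Or.inl ⟨s, hs, e, he, rfl⟩
        · rw [hc] at he
          simp only [Option.some.injEq] at he
          exact Or.inr (by rw [he])
      · rintro (⟨s, hs, e⟩ | rfl)
        · exact ⟨s, by omega, e⟩
        · exact ⟨t, by omega, c, hc, rfl⟩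
    rw [key, h.mem_iff]
    omega

theorem exists_visited (t : ℕ) (c : BBConfig n) (hc : runFor B.step t B.init = some c) :
    ∃ v, B.Visited t c v := by
  induction t generalizing c with
  | zero =>
    simp only [runFor, Option.some.injEq] at hc
    exact ⟨0, hc ▸ Visited.zero⟩
  | succ t ih =>
    obtain ⟨d, hd⟩ := runFor_prefix hc (Nat.le_succ t)
    obtain ⟨v, hv⟩ := ih d hd
    simp only [runFor, hd, Option.bind_some] at hc
    exact ⟨_, hv.succ hd hc⟩

/-- The cell on which the machine halts is visited but perhaps never left; this accounts for the
maximum. -/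
theorem Visited.space_eq {t v : ℕ} {c : BBConfig n} (h : B.Visited t c v)
    (hc : runFor B.step t B.init = some c) (hd : B.step c = none) :
    B.space = max v (c.head + 1) := by
  have hle := h.head_le
  have : {i | ∃ t c, runFor B.step t B.init = some c ∧ c.head = i}
      = (Finset.range (max v (c.head + 1)) : Set ℕ) := by
    ext i
    simp only [Set.mem_ofPred_eq, Finset.coe_range, Set.mem_Iio]
    constructor
    · rintro ⟨s, e, he, hi⟩
      rcases (runFor_le_of_halt hc hd he).lt_or_eq with hs | rfl
      · have := (h.mem_iff i).1 ⟨s, hs, e, he, hi⟩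
        omega
      · rw [hc] at he
        simp only [Option.some.injEq] at he
        subst he
        omega
    · intro hi
      by_cases hv : i < v
      · obtain ⟨s, -, e⟩ := (h.mem_iff i).2 hv
        exact ⟨s, e⟩
      · exact ⟨t, c, hc, by omega⟩
  rw [space, this, Set.ncard_coe_finset, Finset.card_range]

/-- Writing a symbol and leaving its cell are the same step, so each `1` lies in a cell that has
been left. -/
theorem HaltsWithOnes.le_space {k : ℕ} (h : B.HaltsWithOnes k) : k ≤ B.space := by
  obtain ⟨t, c, hr, hc, rfl⟩ := h
  obtain ⟨v, hv⟩ := exists_visited t c hr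
  rw [hv.space_eq hr (step_eq_none_of_δ hc)]
  have hsub : {i | c.tape i = true} ⊆ (Finset.range v : Set ℕ) := by
    intro i hi
    by_contra hlt
    have := hv.blank i (by simpa using hlt)
    simp_all
  have := Set.ncard_le_ncard hsub (Finset.finite_toSet _)
  rw [Set.ncard_coe_finset, Finset.card_range] at this
  omega

end BBMachine

/-! ### The Hennie machine that measures the space of a busy beaver -/

/-- The working symbols of the simulator: an unvisited cell carries the input symbol `inp`, a
visited one the current symbol of the simulated machine. -/
inductive HSym
  | lend | rend | blank | inp
  | bit (b : Bool)

/-- The phases after the simulation: running to the right endmarker, inspecting the last cell, and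
accepting. -/
inductive HPhase
  | sweep | check | acc

instance : Finite HSym :=
  Finite.of_injective (β := Option (Option (Option (Option Bool))))
    (fun s => match s with
      | .lend => none
      | .rend => some none
      | .blank => some (some none)
      | .inp => some (some (some none))
      | .bit b => some (some (some (some b))))
    (by rintro (_ | _ | _ | _ | _) (_ | _ | _ | _ | _) h <;> simp_all)

instance : Finite HPhase :=
  Finite.of_injective (β := Option Bool)
    (fun s => match s with
      | .sweep => none
      | .check => some false
      | .acc => some true)
    (by rintro (_ | _ | _) (_ | _ | _) h <;> simp_all)

/-- The symbol of the simulated machine in a cell between the endmarkers. -/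
def HSym.read : HSym → Option Bool
  | .inp => some false
  | .bit b => some b
  | _ => none

variable {n : ℕ}

/-- The transition function of the simulator. -/
def simδ (B : BBMachine n) : Fin n ⊕ HPhase → HSym → Option ((Fin n ⊕ HPhase) × HSym × Dir)
  -- If `B` halts, its head never falls off the left end, and this transition is used for the first
  -- step only.
  | .inl q, .lend => some (.inl q, .lend, Dir.right)
  -- `read` is undefined on `rend`: a simulation that needs more cells than the input offers halts
  -- there in a non-final state.
  | .inl q, s => s.read.map fun b =>
      match B.δ q b with
      -- The halting cell is written as well, so that it counts as visited.
      | none => (.inr .sweep, .bit b, Dir.right)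
      | some (q', b', d) => (.inl q', .bit b', d)
  | .inr .sweep, .inp => some (.inr .sweep, .inp, Dir.right)
  | .inr .sweep, .bit b => some (.inr .sweep, .bit b, Dir.right)
  | .inr .sweep, .rend => some (.inr .check, .rend, Dir.left)
  | .inr .check, .bit b => some (.inr .acc, .bit b, Dir.right)
  | _, _ => none

/-- The simulator runs `B` between the endmarkers and, when `B` halts, accepts if the last cell has
been visited. -/
def simulator (B : BBMachine n) : EndMarkedDTM Unit where
  Q := Fin n ⊕ HPhase
  Γ := HSym
  finQ := inferInstance
  finΓ := inferInstance
  inp := ⟨fun _ => .inp, fun _ _ _ => rfl⟩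
  blank := .blank
  inp_ne_blank := by simp
  δ := simδ B
  not_write_blank := by
    rintro (p | _ | _ | _) (_ | _ | _ | _ | b) q t d h <;>
      simp only [simδ, HSym.read, Option.map_none, Option.map_some, Option.some.injEq,
        Prod.mk.injEq, reduceCtorEq] at h
    case inl.inp =>
      rcases hδ : B.δ p false with _ | ⟨_, _, _⟩ <;> simp only [hδ, Prod.mk.injEq] at h <;>
        simp [← h.2.1]
    case inl.bit =>
      rcases hδ : B.δ p b with _ | ⟨_, _, _⟩ <;> simp only [hδ, Prod.mk.injEq] at h <;>
        simp [← h.2.1]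
    all_goals simp [← h.2.1]
  q₀ := .inl B.start
  F := {.inr .acc}
  lend := .lend
  rend := .rend
  lend_ne_rend := by simp
  lend_ne_blank := by simp
  rend_ne_blank := by simp
  inp_ne_lend := by simp
  inp_ne_rend := by simp
  δ_lend := by
    rintro (p | _ | _ | _) q t d h <;> simp [simδ] at h
    exact ⟨h.2.1.symm, h.2.2.symm⟩
  δ_rend := by
    rintro (p | _ | _ | _) q t d h <;> simp [simδ, HSym.read] at h
    exact ⟨h.2.1.symm, h.2.2.symm⟩

/-- The tape of the simulator on an input of length `L`, when the simulated machine has visited the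
first `v` cells of its tape `T`. -/
def simTape (L v : ℕ) (T : ℕ → Bool) (i : ℤ) : HSym :=
  if i < 0 then .blank
  else if i = 0 then .lend
  else if i ≤ L then if i ≤ v then .bit (T (i - 1).toNat) else .inp
  else if i = L + 1 then .rend
  else .blank

theorem initTape_simulator (B : BBMachine n) (T : ℕ → Bool) (L : ℕ) :
    (simulator B).initTape (List.replicate L ()) = simTape L 0 T := by
  funext i
  unfold EndMarkedDTM.initTape simTape
  by_cases hi : i < 0
  · simp only [hi, if_true]; rfl
  rw [if_neg hi, if_neg hi]
  obtain ⟨j, rfl⟩ := Int.eq_ofNat_of_zero_le (not_lt.1 hi)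
  rcases j with _ | j
  · rfl
  rw [if_neg (by omega), Int.toNat_natCast, List.getD_cons_succ]
  simp only [List.map_replicate]
  rcases lt_trichotomy j L with h | rfl | h
  · rw [if_pos (by omega), if_neg (by omega), List.getD_append _ _ _ _ (by simpa using h)]
    exact List.getD_replicate _ h
  · rw [if_neg (by omega), if_pos (by omega), List.getD_append_right _ _ _ _ (by simp)]
    simp; rfl
  · rw [if_neg (by omega), if_neg (by omega), List.getD_eq_default _ _ (by simpa using h)]
    rfl

theorem simTape_rend (L v : ℕ) (T : ℕ → Bool) : simTape L v T (L + 1) = .rend := by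
  unfold simTape
  rw [if_neg (by omega), if_neg (by omega), if_neg (by omega), if_pos rfl]

theorem simTape_cell {L v h : ℕ} (T : ℕ → Bool) (hL : h < L) :
    simTape L v T (h + 1) = if h < v then .bit (T h) else .inp := by
  unfold simTape
  rw [if_neg (by omega), if_neg (by omega), if_pos (by omega)]
  by_cases hv : h < v
  · rw [if_pos hv, if_pos (by omega)]
    simp
  · rw [if_neg hv, if_neg (by omega)]

theorem update_simTape {L v h : ℕ} (T : ℕ → Bool) (b : Bool) (hL : h < L) (hv : h ≤ v) :
    Function.update (simTape L v T) (h + 1) (.bit b)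
      = simTape L (max v (h + 1)) (Function.update T h b) := by
  funext i
  by_cases hi : i = h + 1
  · subst hi
    rw [Function.update_self, simTape_cell _ hL, if_pos (by omega), Function.update_self]
  · rw [Function.update_of_ne hi]
    unfold simTape
    split_ifs <;> first | rfl | omega | skip
    rw [Function.update_of_ne (by omega)]

theorem simδ_cell (B : BBMachine n) (q : Fin n) {L v h : ℕ} {T : ℕ → Bool} (hL : h < L)
    (hT : ∀ i, v ≤ i → T i = false) :
    simδ B (.inl q) (simTape L v T (h + 1)) = some (match B.δ q (T h) with
      | none => (.inr .sweep, .bit (T h), Dir.right)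
      | some (q', b', d) => (.inl q', .bit b', d)) := by
  rw [simTape_cell T hL]
  split_ifs with hv
  · simp [simδ, HSym.read]
  · rw [hT h (not_lt.1 hv)]
    simp [simδ, HSym.read]

/-- The configurations of the simulator. -/
abbrev SimConfig (n : ℕ) := Config (Fin n ⊕ HPhase) HSym

/-- The step function of the simulator. -/
def simStep (B : BBMachine n) (c : SimConfig n) : Option (SimConfig n) :=
  (simδ B c.state (c.tape c.head)).map fun r =>
    ⟨r.1, c.head + shift r.2.2, Function.update c.tape c.head r.2.1⟩

/-- The initial configuration of the simulator on an input of length `L`. -/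
def simInit (B : BBMachine n) (L : ℕ) : SimConfig n :=
  ⟨.inl B.start, 0, simTape L 0 fun _ => false⟩

theorem simStep_mk (B : BBMachine n) (q : Fin n ⊕ HPhase) (i : ℤ) (T : ℤ → HSym) :
    simStep B ⟨q, i, T⟩ = (simδ B q (T i)).map fun r =>
      (⟨r.1, i + shift r.2.2, Function.update T i r.2.1⟩ : SimConfig n) := rfl

theorem simStep_simInit (B : BBMachine n) (L : ℕ) :
    simStep B (simInit B L) = some ⟨.inl B.start, 1, simTape L 0 fun _ => false⟩ := by
  have h0 : simTape L 0 (fun _ => false) 0 = .lend := by simp [simTape]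
  rw [simInit, simStep_mk, h0]
  simp only [simδ, Option.map_some, shift, zero_add]
  rw [← h0, Function.update_eq_self]

theorem simStep_sim (B : BBMachine n) {L v : ℕ} {c d : BBConfig n} (hL : c.head < L)
    (hT : ∀ i, v ≤ i → c.tape i = false) (hv : c.head ≤ v) (hd : B.step c = some d) :
    simStep B ⟨.inl c.state, c.head + 1, simTape L v c.tape⟩
      = some ⟨.inl d.state, d.head + 1, simTape L (max v (c.head + 1)) d.tape⟩ := by
  obtain ⟨q, b, D, hδ, hq, htape, hhead⟩ := BBMachine.step_eq_some hd
  rw [simStep_mk, simδ_cell B _ hL hT, hδ]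
  simp only [Option.map_some]
  rw [update_simTape _ _ hL hv, htape, hq, hhead]
  congr 2
  ring

theorem simStep_halt (B : BBMachine n) {L v : ℕ} {c : BBConfig n} (hL : c.head < L)
    (hT : ∀ i, v ≤ i → c.tape i = false) (hv : c.head ≤ v)
    (hd : B.δ c.state (c.tape c.head) = none) :
    simStep B ⟨.inl c.state, c.head + 1, simTape L v c.tape⟩
      = some ⟨.inr .sweep, c.head + 1 + 1, simTape L (max v (c.head + 1)) c.tape⟩ := by
  rw [simStep_mk, simδ_cell B _ hL hT, hd]
  simp only [Option.map_some, shift]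
  rw [update_simTape _ _ hL hv, Function.update_eq_self]

/-- The simulator on an input of length `L` after `B` made `t` steps: either it has kept up, or it
is stuck at the right endmarker. -/
theorem simStep_run (B : BBMachine n) (L t : ℕ) (c : BBConfig n)
    (hc : runFor B.step t B.init = some c) :
    ∃ v, B.Visited t c v ∧
      ((v ≤ L ∧ runFor (simStep B) (t + 1) (simInit B L)
          = some ⟨.inl c.state, c.head + 1, simTape L v c.tape⟩) ∨
        (L < v ∧ ∃ s ≤ t, ∃ q T, T (L + 1 : ℤ) = .rend ∧
          runFor (simStep B) (s + 1) (simInit B L)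
            = some ⟨.inl q, L + 1, T⟩)) := by
  induction t generalizing c with
  | zero =>
    simp only [runFor, Option.some.injEq] at hc
    subst hc
    refine ⟨0, BBMachine.Visited.zero, Or.inl ⟨Nat.zero_le _, ?_⟩⟩
    rw [zero_add, runFor_one, simStep_simInit]
    rfl
  | succ t ih =>
    obtain ⟨d, hd⟩ := runFor_prefix hc (Nat.le_succ t)
    obtain ⟨v, hv, h⟩ := ih d hd
    have hdc : B.step d = some c := by simpa [runFor, hd] using hc
    have hle := hv.head_le
    refine ⟨_, hv.succ hd hdc, ?_⟩
    rcases h with ⟨hvL, hrun⟩ | ⟨hvL, s, hs, q, T, hT, hrun⟩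
    · by_cases hdL : d.head < L
      · refine Or.inl ⟨by omega, ?_⟩
        rw [runFor, hrun, Option.bind_some, simStep_sim B hdL hv.blank hle hdc]
      -- As `d.head ≤ v ≤ L`, the simulated head has just passed the last input cell, and the
      -- simulator scans `rend` in cell `L + 1`.
      · have hdL' : d.head = L := by omega
        refine Or.inr ⟨by omega, t, by omega, d.state, _, simTape_rend L v d.tape, ?_⟩
        rw [hrun, hdL']
    · exact Or.inr ⟨by omega, s, by omega, q, T, hT, hrun⟩

theorem simStep_sweep (B : BBMachine n) (L v : ℕ) (T : ℕ → Bool) (j : ℕ) :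
    ∀ h, h + j = L → runFor (simStep B) j ⟨.inr .sweep, h + 1, simTape L v T⟩
      = some ⟨.inr .sweep, L + 1, simTape L v T⟩ := by
  induction j with
  | zero => rintro h rfl; rfl
  | succ j ih =>
    intro h hL
    rw [Nat.add_comm j 1, runFor_add, runFor_one, simStep_mk]
    have hs : ∀ s, s = simTape L v T (h + 1) → simδ B (.inr .sweep) s
        = some (.inr .sweep, s, Dir.right) := by
      rintro s hs
      rw [simTape_cell T (by omega)] at hs
      split_ifs at hs <;> subst hs <;> rfl
    rw [hs _ rfl]
    simp only [Option.map_some, Function.update_eq_self, shift]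
    exact_mod_cast ih (h + 1) (by omega)

/-- The simulator's halting configurations, and the time it takes. -/
theorem exists_halting_simConfig (B : BBMachine n) {t : ℕ} {c : BBConfig n}
    (hc : runFor B.step t B.init = some c) (hδ : B.δ c.state (c.tape c.head) = none) (L : ℕ) :
    ∃ s ≤ L + (t + 4), ∃ e,
      runFor (simStep B) s (simInit B L) = some e ∧
      simStep B e = none ∧ (e.state = .inr .acc ↔ L = B.space) := by
  obtain ⟨v, hv, h⟩ := simStep_run B L t c hc
  have hspace := hv.space_eq hc (BBMachine.step_eq_none_of_δ hδ)
  have hle := hv.head_le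
  have stuck : ∀ q T, T (L + 1 : ℤ) = .rend →
      simStep B ⟨.inl q, L + 1, T⟩ = none := by
    intro q T hT
    rw [simStep_mk, hT]
    rfl
  rcases h with ⟨hvL, hrun⟩ | ⟨hvL, s, hs, q, T, hT, hrun⟩
  · by_cases hcL : c.head < L
    · set w := max v (c.head + 1) with hw
      -- One step leaves `lend`, `t` steps simulate, one step enters the sweep, and the remaining
      -- input cells are swept. One more step at `rend` and at most one at the last cell give the
      -- bound `L + (t + 4)`.
      have h1 : runFor (simStep B) (t + 2 + (L - (c.head + 1)))
          (simInit B L)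
          = some ⟨.inr .sweep, L + 1, simTape L w c.tape⟩ := by
        refine runFor_trans (s := t + 2) ?_
          (simStep_sweep B L w c.tape (L - (c.head + 1)) (c.head + 1) (by omega))
        rw [runFor, hrun, Option.bind_some, simStep_halt B hcL hv.blank hle hδ]
        push_cast
        rfl
      obtain ⟨l, rfl⟩ : ∃ l, L = l + 1 := ⟨L - 1, by omega⟩
      have h2 : runFor (simStep B) (t + 2 + (l + 1 - (c.head + 1)) + 1)
          (simInit B (l + 1))
          = some ⟨.inr .check, l + 1, simTape (l + 1) w c.tape⟩ := by
        rw [runFor, h1, Option.bind_some, simStep_mk, simTape_rend]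
        simp only [simδ, Option.map_some, shift]
        rw [← simTape_rend (l + 1) w c.tape, Function.update_eq_self]
        push_cast
        simp
      have hcell := simTape_cell (L := l + 1) (v := w) (h := l) c.tape (by omega)
      by_cases hlw : l < w
      · rw [if_pos hlw] at hcell
        refine ⟨_, ?_, _, runFor_trans h2 (t := 1) (e :=
          ⟨.inr .acc, l + 1 + 1, simTape (l + 1) w c.tape⟩) ?_, ?_, ?_⟩
        · omega
        · rw [runFor_one, simStep_mk, hcell]
          simp only [simδ, Option.map_some, shift]
          rw [← hcell, Function.update_eq_self]
        · rw [simStep_mk]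
          rfl
        · rw [hspace]
          simp only [true_iff]
          omega
      · rw [if_neg hlw] at hcell
        refine ⟨_, ?_, _, h2, ?_, ?_⟩
        · omega
        · rw [simStep_mk, hcell]
          rfl
        · rw [hspace]
          simp only [Sum.inr.injEq, reduceCtorEq, false_iff]
          omega
    · have hcL' : c.head = L := by omega
      refine ⟨_, ?_, _, hrun, ?_, ?_⟩
      · omega
      · rw [hcL']
        exact stuck _ _ (simTape_rend _ _ _)
      · rw [hspace]
        simp only [reduceCtorEq, false_iff]
        omega
  · refine ⟨_, ?_, _, hrun, stuck _ _ hT, ?_⟩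
    · omega
    · rw [hspace]
      simp only [reduceCtorEq, false_iff]
      omega

/-! ### The simulator as a Hennie machine and its language -/

theorem simulator_init (B : BBMachine n) (w : List Unit) :
    (simulator B).init w = simInit B w.length := by
  have hw : w = List.replicate w.length () := List.eq_replicate_iff.2 ⟨rfl, fun _ _ => rfl⟩
  rw [EndMarkedDTM.init, hw, initTape_simulator B fun _ => false, List.length_replicate]
  rfl

theorem simulator_halts {B : BBMachine n} {k : ℕ} (h : B.HaltsWithOnes k) :
    ∃ C : ℕ, ∀ w : List Unit, ∃ s ≤ 1 * w.length + C, ∃ e,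
      runFor (simulator B).step s ((simulator B).init w) = some e ∧
      (simulator B).step e = none ∧ (e.state ∈ (simulator B).F ↔ w.length = B.space) := by
  obtain ⟨t, c, hc, hδ, -⟩ := h
  refine ⟨t + 4, fun w => ?_⟩
  rw [simulator_init, one_mul]
  exact exists_halting_simConfig B hc hδ w.length

theorem simulator_isHennie {B : BBMachine n} {k : ℕ} (h : B.HaltsWithOnes k) :
    (simulator B).IsHennie := by
  obtain ⟨C, hC⟩ := simulator_halts h
  refine ⟨1, C, fun w => ?_⟩
  obtain ⟨s, hs, e, he, hn, -⟩ := hC w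
  exact ⟨s, hs, e, he, hn⟩

theorem simulator_language {B : BBMachine n} {k : ℕ} (h : B.HaltsWithOnes k) :
    (simulator B).language = {List.replicate B.space ()} := by
  obtain ⟨C, hC⟩ := simulator_halts h
  ext w
  obtain ⟨s, -, e, he, hn, hF⟩ := hC w
  have hw : w ∈ ({List.replicate B.space ()} : Language Unit) ↔ w.length = B.space :=
    List.eq_replicate_iff.trans (and_iff_left fun _ _ => rfl)
  rw [hw, ← hF]
  constructor
  · rintro ⟨s', e', he', hn', hF'⟩
    rwa [halt_unique he hn he' hn']
  · intro h
    exact ⟨s, e, he, hn, h⟩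

theorem card_simulator_Q (B : BBMachine n) :
    Nat.card (simulator B).Q = n + Nat.card HPhase := by
  change Nat.card (Fin n ⊕ HPhase) = _
  rw [Nat.card_sum, Nat.card_fin]

/-! ### While programs -/

/-- While programs over registers that hold natural numbers. -/
inductive Prog
  | inc (r : ℕ)
  | dec (r : ℕ)
  | seq (P P' : Prog)
  | loop (r : ℕ) (P : Prog)

/-- The big-step semantics: `loop r P` repeats `P` while the register `r` is positive. -/
inductive Exec : Prog → (ℕ → ℕ) → (ℕ → ℕ) → Prop
  | inc (r σ) : Exec (.inc r) σ (Function.update σ r (σ r + 1))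
  | dec (r σ) : Exec (.dec r) σ (Function.update σ r (σ r - 1))
  | seq {P P' σ τ ρ} : Exec P σ τ → Exec P' τ ρ → Exec (.seq P P') σ ρ
  | loop_zero {r P σ} : σ r = 0 → Exec (.loop r P) σ σ
  | loop_pos {r P σ τ ρ} : σ r ≠ 0 → Exec P σ τ → Exec (.loop r P) τ ρ → Exec (.loop r P) σ ρ

/-- All registers of the program are below `b`. -/
def Prog.Below (b : ℕ) : Prog → Prop
  | .inc r => r < b
  | .dec r => r < b
  | .seq P P' => P.Below b ∧ P'.Below b
  | .loop r P => r < b ∧ P.Below b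

theorem Prog.Below.mono {b b' : ℕ} (h : b ≤ b') {P : Prog} (hP : P.Below b) : P.Below b' := by
  induction P with
  | inc r => exact lt_of_lt_of_le hP h
  | dec r => exact lt_of_lt_of_le hP h
  | seq P P' ih ih' => exact ⟨ih hP.1, ih' hP.2⟩
  | loop r P ih => exact ⟨lt_of_lt_of_le hP.1 h, ih hP.2⟩

theorem Prog.exists_below (P : Prog) : ∃ b, P.Below b := by
  induction P with
  | inc r => exact ⟨r + 1, Nat.lt_succ_self r⟩
  | dec r => exact ⟨r + 1, Nat.lt_succ_self r⟩
  | seq P P' ih ih' =>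
    obtain ⟨b, hb⟩ := ih
    obtain ⟨b', hb'⟩ := ih'
    exact ⟨max b b', hb.mono (le_max_left _ _), hb'.mono (le_max_right _ _)⟩
  | loop r P ih =>
    obtain ⟨b, hb⟩ := ih
    exact ⟨max (r + 1) b, lt_of_lt_of_le (Nat.lt_succ_self r) (le_max_left _ _),
      hb.mono (le_max_right _ _)⟩

/-! ### Fragments of two-symbol machines -/

/-- A machine on the tape infinite to the right with total transitions and an exit, `none`. -/
structure Frag where
  Q : Type
  finQ : Finite Q
  start : Q
  δ : Q → Bool → Option Q × Bool × Dir

attribute [instance] Frag.finQ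

namespace Frag

/-- State (`none` after the exit), head position and tape. -/
abbrev Cfg (F : Frag) := Option F.Q × ℕ × (ℕ → Bool)

/-- One step of a fragment. -/
inductive Step (F : Frag) : F.Cfg → F.Cfg → Prop
  | right {q p T r b} : F.δ q (T p) = (r, b, Dir.right) →
      Step F (some q, p, T) (r, p + 1, Function.update T p b)
  | left {q p T r b} : F.δ q (T (p + 1)) = (r, b, Dir.left) →
      Step F (some q, p + 1, T) (r, p, Function.update T (p + 1) b)

/-- Finitely many steps of a fragment. -/
abbrev Steps (F : Frag) : F.Cfg → F.Cfg → Prop := Relation.ReflTransGen F.Step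

variable {F G : Frag}

theorem Step.right_keep {q : F.Q} {p : ℕ} {T : ℕ → Bool} {r : Option F.Q}
    (h : F.δ q (T p) = (r, T p, Dir.right)) : F.Step (some q, p, T) (r, p + 1, T) := by
  simpa using Step.right h

theorem Step.left_keep {q : F.Q} {p : ℕ} {T : ℕ → Bool} {r : Option F.Q}
    (h : F.δ q (T (p + 1)) = (r, T (p + 1), Dir.left)) :
    F.Step (some q, p + 1, T) (r, p, T) := by
  simpa using Step.left h

/-- If `G` contains a copy of `F` with the exit redirected to `e`, every step of `F` is a step of
`G`. Sequences and loops both embed their parts in this way. -/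
theorem Steps.map (g : F.Q → G.Q) (e : Option G.Q)
    (h : ∀ q b, G.δ (g q) b = ((F.δ q b).1.elim e fun q' => some (g q'), (F.δ q b).2))
    {c d : F.Cfg} (hcd : F.Steps c d) :
    G.Steps (c.1.elim e fun q => some (g q), c.2) (d.1.elim e fun q => some (g q), d.2) := by
  refine Relation.ReflTransGen.lift (p := G.Step)
    (fun c : F.Cfg => ((c.1.elim e fun q => some (g q), c.2) : G.Cfg)) ?_ _ _ hcd
  rintro _ _ (⟨hδ⟩ | ⟨hδ⟩)
  · exact Step.right (by rw [h, hδ])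
  · exact Step.left (by rw [h, hδ])

/-- Running `F`, then `G`. -/
abbrev seq (F G : Frag) : Frag where
  Q := F.Q ⊕ G.Q
  finQ := inferInstance
  start := .inl F.start
  δ
    | .inl q, b => ((F.δ q b).1.elim (some (.inr G.start)) fun q' => some (.inl q'), (F.δ q b).2)
    | .inr q, b => ((G.δ q b).1.elim none fun q' => some (.inr q'), (G.δ q b).2)

theorem seq_steps {p p' p'' : ℕ} {T T' T'' : ℕ → Bool}
    (h : F.Steps (some F.start, p, T) (none, p', T'))
    (h' : G.Steps (some G.start, p', T') (none, p'', T'')) :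
    (F.seq G).Steps (some (F.seq G).start, p, T) (none, p'', T'') :=
  (Steps.map (G := F.seq G) Sum.inl (some (.inr G.start)) (fun _ _ => rfl) h).trans
    (Steps.map (G := F.seq G) Sum.inr none (fun _ _ => rfl) h')

theorem card_seq (F G : Frag) : Nat.card (F.seq G).Q = Nat.card F.Q + Nat.card G.Q :=
  Nat.card_sum

/-! ### Registers on interleaved tracks -/

/-- The tape is cut into blocks of `k` cells. The first track marks the blocks `1, …, m`, and the
track `r + 1` contains the value of the register `r` in unary. -/
def enc (k : ℕ) (σ : ℕ → ℕ) (m p : ℕ) : Bool :=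
  if p % k = 0 then decide (0 < p / k ∧ p / k ≤ m) else decide (p / k < σ (p % k - 1))

variable {k r : ℕ} {σ : ℕ → ℕ} {m : ℕ}

theorem natCast_eq_iff {p r : ℕ} (hr : r + 1 < k) :
    (p : ZMod k) = ((r + 1 : ℕ) : ZMod k) ↔ p % k = r + 1 := by
  rw [ZMod.natCast_eq_natCast_iff', Nat.mod_eq_of_lt hr]

theorem natCast_eq_zero_iff {p : ℕ} : (p : ZMod k) = 0 ↔ p % k = 0 := by
  rw [ZMod.natCast_eq_zero_iff, Nat.dvd_iff_mod_eq_zero]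

theorem enc_reg {p r : ℕ} (hp : p % k = r + 1) : enc k σ m p = decide (p / k < σ r) := by
  simp [enc, hp]

theorem enc_mark {p : ℕ} (hp : p % k = 0) :
    enc k σ m p = decide (0 < p / k ∧ p / k ≤ m) := by
  simp [enc, hp]

theorem block_mod {v r : ℕ} (hr : r + 1 < k) : (k * v + (r + 1)) % k = r + 1 := by
  rw [Nat.mul_add_mod, Nat.mod_eq_of_lt hr]

theorem block_div {v r : ℕ} (hr : r + 1 < k) : (k * v + (r + 1)) / k = v := by
  rw [Nat.mul_add_div (by omega), Nat.div_eq_of_lt hr, Nat.add_zero]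

theorem eq_block {p : ℕ} : p = k * (p / k) + p % k := (Nat.div_add_mod p k).symm

/-- Writing in a cell of a register track. -/
theorem update_enc_reg {v r : ℕ} (hr : r + 1 < k) {b : Bool} {w : ℕ}
    (h : ∀ j, decide (j < w) = if j = v then b else decide (j < σ r)) :
    Function.update (enc k σ m) (k * v + (r + 1)) b = enc k (Function.update σ r w) m := by
  funext p
  by_cases hp : p = k * v + (r + 1)
  · subst hp
    rw [Function.update_self, enc_reg (block_mod hr), block_div hr, Function.update_self, h,
      if_pos rfl]
  · rw [Function.update_of_ne hp]
    unfold enc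
    split_ifs with h0
    · rfl
    · by_cases hpr : p % k - 1 = r
      · rw [hpr, Function.update_self, h, if_neg]
        rintro rfl
        apply hp
        have := eq_block (k := k) (p := p)
        omega
      · rw [Function.update_of_ne hpr]

/-- Marking the next block. -/
theorem update_enc_mark {u : ℕ} (hk : 0 < k) (hu : u ≤ m) :
    Function.update (enc k σ m) (k * (u + 1)) true = enc k σ (max m (u + 1)) := by
  funext p
  by_cases hp : p = k * (u + 1)
  · subst hp
    rw [Function.update_self, enc_mark (Nat.mul_mod_right _ _), Nat.mul_div_cancel_left _ hk]
    simp
  · rw [Function.update_of_ne hp]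
    unfold enc
    split_ifs with h0
    · have h1 : p / k ≠ u + 1 := by
        intro h
        have := eq_block (k := k) (p := p)
        rw [h, h0] at this
        omega
      congr 1
      ext
      omega
    · rfl

/-! ### Walking -/

/-- The state carries the head position modulo `k`, which is enough to know the track under the
head. -/
theorem walk_left (s : ZMod k → F.Q) {T : ℕ → Bool} {lo : ℕ} (d : ℕ)
    (h : ∀ p : ℕ, lo < p → p ≤ lo + d →
      F.δ (s p) (T p) = (some (s (p - 1)), T p, Dir.left)) :
    F.Steps (some (s (lo + d : ℕ)), lo + d, T) (some (s lo), lo, T) := by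
  induction d with
  | zero => exact Relation.ReflTransGen.refl
  | succ d ih =>
    refine Relation.ReflTransGen.head (b := (some (s (lo + d : ℕ)), lo + d, T)) ?_
      (ih fun p hp hp' => h p hp (by omega))
    refine Step.left_keep ((h (lo + d + 1) (by omega) (by omega)).trans ?_)
    push_cast
    simp

theorem walk_right (s : ZMod k → F.Q) {T : ℕ → Bool} {lo : ℕ} (d : ℕ)
    (h : ∀ p : ℕ, lo ≤ p → p < lo + d →
      F.δ (s p) (T p) = (some (s (p + 1)), T p, Dir.right)) :
    F.Steps (some (s lo), lo, T) (some (s (lo + d : ℕ)), lo + d, T) := by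
  induction d with
  | zero => exact Relation.ReflTransGen.refl
  | succ d ih =>
    refine Relation.ReflTransGen.tail (ih fun p hp hp' => h p hp (by omega)) ?_
    refine Step.right_keep ((h (lo + d) (by omega) (by omega)).trans ?_)
    push_cast
    simp [add_assoc]

/-- Walking left to the beginning of the tape, and then to the first register track. -/
theorem walk_home (s : ZMod k → F.Q) (r : Option F.Q)
    (h0 : F.δ (s 0) false = (r, false, Dir.right))
    (h1 : F.δ (s 0) true = (some (s (0 - 1)), true, Dir.left))
    (h : ∀ j b, j ≠ 0 → F.δ (s j) b = (some (s (j - 1)), b, Dir.left))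
    {p : ℕ} (hp : p < k * (m + 1)) :
    F.Steps (some (s p), p, enc k σ m) (r, 1, enc k σ m) := by
  have hw := walk_left (F := F) s (T := enc k σ m) (lo := 0) p (by
    intro q hq0 hq
    by_cases hq' : (q : ZMod k) = 0
    · have hmod := natCast_eq_zero_iff.1 hq'
      have hblock := eq_block (k := k) (p := q)
      rw [hmod] at hblock
      have : q / k < m + 1 := Nat.div_lt_of_lt_mul (by omega)
      have : 0 < q / k := Nat.pos_of_ne_zero fun h => by rw [h] at hblock; omega
      rw [hq', enc_mark hmod, decide_eq_true (by omega)]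
      exact h1
    · exact h _ _ hq')
  rw [zero_add] at hw
  refine hw.tail (Step.right_keep ?_)
  rw [enc_mark (Nat.zero_mod k)]
  simpa using h0

/-- Walking right from the first register track to the first blank cell of a register track,
marking all blocks on the way. -/
theorem walk_mark (s : ZMod k → F.Q) {r : ℕ} (hr : r + 1 < k)
    (h0 : ∀ b, F.δ (s 0) b = (some (s 1), true, Dir.right))
    (h : ∀ (j : ZMod k) b, j ≠ 0 → ¬ (j = (r + 1 : ℕ) ∧ b = false) →
      F.δ (s j) b = (some (s (j + 1)), b, Dir.right)) {u : ℕ} (hu : u ≤ σ r) :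
    F.Steps (some (s 1), 1, enc k σ m)
      (some (s (r + 1 : ℕ)), k * u + (r + 1), enc k σ (max m u)) := by
  -- Inside a block, a walk is not stopped by the register track if it ends before passing that
  -- track, or if the cell there is still `1` because `u < σ r`.
  have main : ∀ u i : ℕ, i < r + 1 ∨ u < σ r → i + 1 < k →
      F.Steps (some (s (k * u + 1 : ℕ)), k * u + 1, enc k σ (max m u))
        (some (s (k * u + 1 + i : ℕ)), k * u + 1 + i, enc k σ (max m u)) := by
    intro u i hi hik
    refine walk_right s i fun p hp hp' => h _ _ ?_ ?_
    all_goals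
      obtain ⟨x, rfl⟩ : ∃ x, p = k * u + (x + 1) := ⟨p - (k * u + 1), by omega⟩
      have hx : x + 1 < k := by omega
    · rw [Ne, natCast_eq_zero_iff, block_mod hx]
      omega
    · rw [natCast_eq_iff hr, block_mod hx]
      rintro ⟨hxr, hb⟩
      rw [enc_reg (block_mod hx), block_div hx, decide_eq_false_iff_not] at hb
      have : x = r := by omega
      subst this
      omega
  have blocks : ∀ u, u ≤ σ r → F.Steps (some (s 1), 1, enc k σ m)
      (some (s (k * u + 1 : ℕ)), k * u + 1, enc k σ (max m u)) := by
    intro u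
    induction u with
    | zero =>
      intro _
      simp only [mul_zero, zero_add, Nat.cast_one, Nat.max_zero]
      exact Relation.ReflTransGen.refl
    | succ u ih =>
      intro hu
      refine ((ih (by omega)).trans (main u (k - 2) (Or.inr hu) (by omega))).trans ?_
      have e1 : k * u + 1 + (k - 2) = k * u + (k - 2 + 1) := by omega
      have e2 : k * (u + 1) = k * u + (k - 2 + 1) + 1 := by rw [mul_add]; omega
      -- From the last cell of block `u`, one step reaches the first cell of block `u + 1` and a
      -- second step marks it.
      refine Relation.ReflTransGen.head
        (b := (some (s (k * (u + 1) : ℕ)), k * (u + 1), enc k σ (max m u))) ?_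
        (Relation.ReflTransGen.single ?_)
      · rw [e1, e2]
        refine Step.right_keep ((h _ _ ?_ ?_).trans (by push_cast; rfl))
        · rw [Ne, natCast_eq_zero_iff, block_mod (by omega)]
          omega
        · rw [natCast_eq_iff hr, block_mod (by omega)]
          rintro ⟨hxr, hb⟩
          rw [enc_reg (r := r) (by rw [block_mod (by omega), hxr]), block_div (by omega),
            decide_eq_false_iff_not] at hb
          omega
      · have := Step.right (F := F) (q := s (k * (u + 1) : ℕ)) (p := k * (u + 1))
          (T := enc k σ (max m u)) (r := some (s (k * (u + 1) + 1 : ℕ))) (b := true) (by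
            push_cast
            simp only [CharP.cast_eq_zero, zero_mul, zero_add]
            exact h0 _)
        rwa [update_enc_mark (by omega) (le_max_right _ _), max_assoc,
          max_eq_right (Nat.le_succ u)] at this
  have hfin := (blocks u hu).trans (main u r (by omega) hr)
  have e : k * u + 1 + r = k * u + (r + 1) := by omega
  rw [e] at hfin
  convert hfin using 4
  push_cast
  simp

theorem reg_ne_zero (hr : r + 1 < k) : ((r + 1 : ℕ) : ZMod k) ≠ 0 := by
  rw [Ne, natCast_eq_zero_iff, Nat.mod_eq_of_lt hr]
  omega

theorem cast_block (v : ℕ) : ((k * v + (r + 1) : ℕ) : ZMod k) = (r + 1 : ℕ) := by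
  push_cast
  simp

/-! ### The instructions -/

/-- Phases of an instruction fragment: walking right, looking for the last `1`, walking home. -/
inductive Phase
  | out | find | home

instance : Finite Phase :=
  Finite.of_injective (β := Option Bool)
    (fun s => match s with
      | .out => none
      | .find => some false
      | .home => some true)
    (by rintro (_ | _ | _) (_ | _ | _) h <;> simp_all)

/-- Incrementing the register `r`. -/
abbrev inc (k r : ℕ) [NeZero k] : Frag where
  Q := Bool × ZMod k
  finQ := have := ZMod.fintype k; inferInstance
  start := (true, 1)
  δ
    | (true, j), b =>
      if j = 0 then (some (true, 1), true, Dir.right)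
      else if j = (r + 1 : ℕ) ∧ b = false then (some (false, j - 1), true, Dir.left)
      else (some (true, j + 1), b, Dir.right)
    | (false, j), b =>
      if j = 0 ∧ b = false then (none, b, Dir.right)
      else (some (false, j - 1), b, Dir.left)

/-- Decrementing the register `r`. -/
abbrev dec (k r : ℕ) [NeZero k] : Frag where
  Q := Phase × ZMod k
  finQ := have := ZMod.fintype k; inferInstance
  start := (.out, 1)
  δ
    | (.out, j), b =>
      if j = 0 then (some (.out, 1), true, Dir.right)
      else if j = (r + 1 : ℕ) ∧ b = false then (some (.find, j - 1), b, Dir.left)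
      else (some (.out, j + 1), b, Dir.right)
    | (.find, j), b =>
      if j = 0 ∧ b = false then (none, b, Dir.right)
      else if j = (r + 1 : ℕ) ∧ b = true then (some (.home, j - 1), false, Dir.left)
      else (some (.find, j - 1), b, Dir.left)
    | (.home, j), b =>
      if j = 0 ∧ b = false then (none, b, Dir.right)
      else (some (.home, j - 1), b, Dir.left)

/-- Repeating `F` while the register `r` is positive. -/
abbrev loop (k r : ℕ) [NeZero k] (F : Frag) : Frag where
  Q := (Option Bool × ZMod k) ⊕ F.Q
  finQ := have := ZMod.fintype k; inferInstance
  start := .inl (none, 1)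
  δ
    | .inl (none, j), b =>
      if j = (r + 1 : ℕ) then (some (.inl (some b, j - 1)), b, Dir.left)
      else (some (.inl (none, j + 1)), b, Dir.right)
    | .inl (some v, j), b =>
      if j = 0 ∧ b = false then (if v then some (.inr F.start) else none, b, Dir.right)
      else (some (.inl (some v, j - 1)), b, Dir.left)
    | .inr q, b =>
      ((F.δ q b).1.elim (some (.inl (none, 1))) fun q' => some (.inr q'), (F.δ q b).2)

/-! ### Correctness of the instruction fragments -/

variable [NeZero k]

/-- The new `1` goes into block `σ r`, the first blank one on the track. All blocks up to there have
been marked on the way out, so the way home is safe. -/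
theorem inc_steps (hr : r + 1 < k) :
    ∃ m', (inc k r).Steps (some (inc k r).start, 1, enc k σ m)
      (none, 1, enc k (Function.update σ r (σ r + 1)) m') := by
  refine ⟨max m (σ r), ?_⟩
  have h1 := walk_mark (F := inc k r) (σ := σ) (m := m) (fun j => (true, j)) hr
    (fun b => by simp [inc]) (fun j b hj hb => by simp only [inc]; rw [if_neg hj, if_neg hb])
    le_rfl
  refine h1.trans (Relation.ReflTransGen.head (b := (some (false, ((k * σ r + r : ℕ) : ZMod k)),
    k * σ r + r, enc k (Function.update σ r (σ r + 1)) (max m (σ r)))) ?_ ?_)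
  · have := Step.left (F := inc k r) (q := (true, ((r + 1 : ℕ) : ZMod k))) (p := k * σ r + r)
      (T := enc k σ (max m (σ r))) (b := true)
      (r := some (false, ((k * σ r + r : ℕ) : ZMod k))) (by
        rw [add_assoc, enc_reg (r := r) (block_mod hr), block_div (v := σ r) hr]
        simp only [inc]
        rw [if_neg (reg_ne_zero hr), if_pos (by simp)]
        push_cast
        simp)
    rwa [add_assoc, update_enc_reg (w := σ r + 1) hr] at this
    intro j
    split_ifs with h
    · simp [h]
    · congr 1
      ext
      omega
  · refine walk_home (F := inc k r) (fun j => (false, j)) none (by simp [inc]) (by simp [inc])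
      (fun j b hj => by simp [inc, hj]) ?_
    have : k * σ r ≤ k * max m (σ r) := Nat.mul_le_mul_left _ (le_max_right _ _)
    rw [mul_add]
    omega

theorem dec_steps (hr : r + 1 < k) :
    ∃ m', (dec k r).Steps (some (dec k r).start, 1, enc k σ m)
      (none, 1, enc k (Function.update σ r (σ r - 1)) m') := by
  refine ⟨max m (σ r), ?_⟩
  have h1 := walk_mark (F := dec k r) (σ := σ) (m := m) (fun j => (.out, j)) hr
    (fun b => by simp [dec]) (fun j b hj hb => by simp only [dec]; rw [if_neg hj, if_neg hb])
    le_rfl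
  set M := max m (σ r) with hM
  have hσM : σ r ≤ M := le_max_right _ _
  have hkM : ∀ v ≤ M, k * v + (r + 1) < k * (M + 1) := fun v hv => by
    have := Nat.mul_le_mul_left k hv
    rw [mul_add]
    omega
  refine h1.trans (Relation.ReflTransGen.head (b := (some (.find, ((k * σ r + r : ℕ) : ZMod k)),
    k * σ r + r, enc k σ M)) ?_ ?_)
  · refine Step.left_keep (F := dec k r) (p := k * σ r + r) ?_
    rw [add_assoc, enc_reg (r := r) (block_mod hr), block_div (v := σ r) hr]
    simp only [dec]
    rw [if_neg (reg_ne_zero hr), if_pos (by simp)]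
    push_cast
    simp
  -- The search starts just left of the first blank of the track. If the register is `0`, no other
  -- cell of the track lies before cell `0`, and nothing changes; otherwise the `1` to erase is in
  -- block `u`.
  rcases hv : σ r with _ | u
  · have hw := walk_left (F := dec k r) (fun j : ZMod k => (.find, j)) (T := enc k σ M) (lo := 0) r
      (by
        intro p hp hp'
        have hpk : p % k = p := Nat.mod_eq_of_lt (by omega)
        simp only [dec]
        rw [if_neg, if_neg]
        · rw [natCast_eq_iff hr, hpk]
          omega
        · rw [natCast_eq_zero_iff, hpk]
          omega)
    rw [zero_add] at hw
    rw [mul_zero, zero_add, ← hv, show σ r - 1 = σ r by omega, Function.update_eq_self]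
    refine hw.tail (Step.right_keep (F := dec k r) ?_)
    rw [enc_mark (Nat.zero_mod k)]
    simp [dec]
  · have hu : σ r - 1 = u := by omega
    have hw := walk_left (F := dec k r) (fun j : ZMod k => (.find, j)) (T := enc k σ M)
      (lo := k * u + (r + 1)) (k - 1)
      (by
        intro p hp hp'
        -- The `k - 1` cells after the last `1` contain no cell of its track, and their only
        -- first-track cell belongs to block `u + 1`, which is marked since `u + 1 ≤ M`. So the
        -- search neither erases nor exits early.
        have hpu : u ≤ p / k := (Nat.le_div_iff_mul_le (by omega)).2 (by rw [mul_comm]; omega)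
        have hpu' : p / k < u + 2 := Nat.div_lt_of_lt_mul (by rw [mul_add]; omega)
        have hb := eq_block (k := k) (p := p)
        have hlt := Nat.mod_lt p (show k > 0 by omega)
        obtain hpu | hpu : p / k = u ∨ p / k = u + 1 := by omega
        · rw [hpu] at hb
          simp only [dec]
          rw [if_neg, if_neg]
          · rw [natCast_eq_iff hr]
            omega
          · rw [natCast_eq_zero_iff]
            omega
        · rw [hpu, mul_add] at hb
          simp only [dec]
          rw [if_neg, if_neg]
          · rw [natCast_eq_iff hr]
            omega
          · rw [natCast_eq_zero_iff]
            rintro ⟨hp0, hf⟩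
            rw [enc_mark hp0, hpu, decide_eq_false_iff_not] at hf
            omega)
    have e : k * (u + 1) + r = k * u + (r + 1) + (k - 1) := by rw [mul_add]; omega
    rw [e, show u + 1 - 1 = u from rfl]
    refine hw.trans (Relation.ReflTransGen.head (b := (some (.home, ((k * u + r : ℕ) : ZMod k)),
      k * u + r, enc k (Function.update σ r u) M)) ?_ ?_)
    · have := Step.left (F := dec k r) (q := (.find, ((k * u + (r + 1) : ℕ) : ZMod k)))
        (p := k * u + r) (T := enc k σ M) (b := false)
        (r := some (.home, ((k * u + r : ℕ) : ZMod k))) (by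
          rw [add_assoc, enc_reg (r := r) (block_mod hr), block_div (v := u) hr, cast_block]
          simp only [dec]
          rw [if_neg (fun h => reg_ne_zero hr h.1), if_pos (by simp [hv])]
          push_cast
          simp)
      rwa [add_assoc, update_enc_reg (w := u) hr] at this
      intro j
      split_ifs with h
      · simp [h]
      · congr 1
        ext
        omega
    · refine walk_home (F := dec k r) (fun j => (.home, j)) none (by simp [dec]) (by simp [dec])
        (fun j b hj => by simp [dec, hj]) ?_
      have := hkM u (by omega)
      omega

/-- A register is positive exactly when its cell in block `0` is `1`, so the test never leaves this
block. -/
theorem loop_test (hr : r + 1 < k) (F : Frag) :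
    (loop k r F).Steps (some (loop k r F).start, 1, enc k σ m)
      (if σ r ≠ 0 then some (.inr F.start) else none, 1, enc k σ m) := by
  have hw := walk_right (F := loop k r F) (fun j : ZMod k => .inl (none, j)) (T := enc k σ m)
    (lo := 1) r (by
      intro p hp hp'
      simp only [loop]
      rw [if_neg]
      rw [natCast_eq_iff hr, Nat.mod_eq_of_lt (by omega)]
      omega)
  rw [Nat.cast_one] at hw
  refine hw.trans (Relation.ReflTransGen.head (b := (some (.inl (some (decide (σ r ≠ 0)),
    ((r : ℕ) : ZMod k))), r, enc k σ m)) ?_ ?_)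
  · rw [Nat.add_comm 1 r]
    refine Step.left_keep (F := loop k r F) ?_
    rw [enc_reg (r := r) (Nat.mod_eq_of_lt hr), Nat.div_eq_of_lt hr]
    simp only [loop]
    rw [if_pos trivial]
    push_cast
    simp [Nat.pos_iff_ne_zero]
  · have := walk_home (F := loop k r F) (σ := σ) (m := m) (p := r)
      (fun j : ZMod k => .inl (some (decide (σ r ≠ 0)), j))
      (if decide (σ r ≠ 0) then some (.inr F.start) else none) (by simp [loop]) (by simp [loop])
      (fun j b hj => by simp [loop, hj]) (by rw [mul_add]; omega)
    simpa only [decide_eq_true_eq] using this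

theorem loop_body (F : Frag) {p p' : ℕ} {T T' : ℕ → Bool}
    (h : F.Steps (some F.start, p, T) (none, p', T')) :
    (loop k r F).Steps (some (.inr F.start), p, T) (some (loop k r F).start, p', T') :=
  Steps.map (G := loop k r F) Sum.inr (some (.inl (none, 1))) (fun _ _ => rfl) h

/-- The fragment executes the program on the encoded registers. -/
def Implements (k : ℕ) (F : Frag) (P : Prog) : Prop :=
  ∀ σ τ, Exec P σ τ → ∀ m, ∃ m', F.Steps (some F.start, 1, enc k σ m) (none, 1, enc k τ m')

omit [NeZero k] in
theorem implements_seq {F G : Frag} {P P' : Prog} (hF : Implements k F P)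
    (hG : Implements k G P') : Implements k (F.seq G) (.seq P P') := by
  rintro σ τ h m
  cases h with
  | seq h h' =>
    obtain ⟨m', hm'⟩ := hF _ _ h m
    obtain ⟨m'', hm''⟩ := hG _ _ h' m'
    exact ⟨m'', seq_steps hm' hm''⟩

theorem implements_inc (hr : r + 1 < k) : Implements k (inc k r) (.inc r) := by
  rintro σ τ h m
  cases h
  exact inc_steps hr

theorem implements_dec (hr : r + 1 < k) : Implements k (dec k r) (.dec r) := by
  rintro σ τ h m
  cases h
  exact dec_steps hr

theorem implements_loop (hr : r + 1 < k) {F : Frag} {P : Prog} (hF : Implements k F P) :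
    Implements k (loop k r F) (.loop r P) := by
  rintro σ τ h
  -- The induction runs over the derivation of `Exec`, because the number of rounds is not visible
  -- in the program.
  generalize hL : Prog.loop r P = L at h
  induction h with
  | inc => cases hL
  | dec => cases hL
  | seq => cases hL
  | loop_zero h =>
    cases hL
    intro m
    have := loop_test (σ := ‹ℕ → ℕ›) (m := m) hr F
    rw [if_neg (not_not.2 h)] at this
    exact ⟨m, this⟩
  | loop_pos h h1 h2 _ ih =>
    cases hL
    intro m
    obtain ⟨m', hm'⟩ := hF _ _ h1 m
    obtain ⟨m'', hm''⟩ := ih rfl m'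
    rename_i σ' _ _ _
    have := loop_test (σ := σ') (m := m) hr F
    rw [if_pos h] at this
    exact ⟨m'', (this.trans (loop_body F hm')).trans hm''⟩

/-- One of the `k` tracks holds the marks, which leaves room for `k - 1` registers. -/
theorem exists_implements (P : Prog) (hP : P.Below (k - 1)) : ∃ F, Implements k F P := by
  induction P with
  | inc r => exact ⟨_, implements_inc (show r + 1 < k from by have : r < k - 1 := hP; omega)⟩
  | dec r => exact ⟨_, implements_dec (show r + 1 < k from by have : r < k - 1 := hP; omega)⟩
  | seq P P' ih ih' =>
    obtain ⟨F, hF⟩ := ih hP.1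
    obtain ⟨G, hG⟩ := ih' hP.2
    exact ⟨_, implements_seq hF hG⟩
  | loop r P ih =>
    obtain ⟨F, hF⟩ := ih hP.2
    exact ⟨_, implements_loop (by have := hP.1; omega) hF⟩

end Frag

/-! ### Partial recursive functions by while programs -/

/-- Total correctness of loops: `I j` is the invariant with exactly `j` rounds left. -/
theorem exec_loop {r : ℕ} {P : Prog} (I : ℕ → (ℕ → ℕ) → Prop)
    (h0 : ∀ σ, I 0 σ → σ r = 0)
    (h1 : ∀ j σ, I (j + 1) σ → σ r ≠ 0 ∧ ∃ τ, Exec P σ τ ∧ I j τ) {j : ℕ} {σ : ℕ → ℕ}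
    (h : I j σ) : ∃ τ, Exec (.loop r P) σ τ ∧ I 0 τ := by
  induction j generalizing σ with
  | zero => exact ⟨σ, .loop_zero (h0 σ h), h⟩
  | succ j ih =>
    obtain ⟨hr, τ, hτ, hI⟩ := h1 j σ h
    obtain ⟨ρ, hρ, hI'⟩ := ih hI
    exact ⟨ρ, .loop_pos hr hτ hρ, hI'⟩

/-- Started on `σ`, the program puts `y` into the register `out` and does not change any other
register below `b`. -/
def Assigns (b : ℕ) (P : Prog) (σ : ℕ → ℕ) (out y : ℕ) : Prop :=
  ∃ τ, Exec P σ τ ∧ τ out = y ∧ ∀ r < b, r ≠ out → τ r = σ r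

/-- Resetting a register. -/
def Prog.clear (r : ℕ) : Prog := .loop r (.dec r)

theorem exec_clear (r : ℕ) (σ : ℕ → ℕ) :
    Exec (.clear r) σ (Function.update σ r 0) := by
  obtain ⟨τ, hτ, hr, ho⟩ := exec_loop (r := r) (P := .dec r)
    (fun j τ => τ r = j ∧ ∀ s, s ≠ r → τ s = σ s) (fun _ h => h.1)
    (by
      rintro j τ ⟨hr, ho⟩
      refine ⟨by omega, _, .dec r τ, by simp [hr], fun s hs => ?_⟩
      rw [Function.update_of_ne hs, ho s hs])
    (j := σ r) (σ := σ) ⟨rfl, fun _ _ => rfl⟩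
  have : τ = Function.update σ r 0 := by
    funext s
    by_cases hs : s = r
    · subst hs
      simp [hr]
    · rw [Function.update_of_ne hs, ho s hs]
  exact this ▸ hτ

/-- Copying a register with the help of the register `s`. -/
def Prog.copy (src dst s : ℕ) : Prog :=
  .seq (.clear dst) (.seq (.clear s) (.seq
    (.loop src (.seq (.dec src) (.seq (.inc dst) (.inc s))))
    (.loop s (.seq (.dec s) (.inc src)))))

/-- Emptying `src` fills both `dst` and the scratch register `b`; emptying `b` then restores `src`.
-/
theorem assigns_copy {src dst b : ℕ} (hs : src < b) (hd : dst < b) (hsd : src ≠ dst)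
    (σ : ℕ → ℕ) : Assigns b (.copy src dst b) σ dst (σ src) := by
  have hsb : src ≠ b := hs.ne
  have hdb : dst ≠ b := hd.ne
  obtain ⟨τ, hτ, hτs, hτd, hτb, hτo⟩ := exec_loop (r := src)
    (P := .seq (.dec src) (.seq (.inc dst) (.inc b)))
    (fun j τ => τ src = j ∧ τ dst + j = σ src ∧ τ b + j = σ src ∧
      ∀ r, r ≠ src → r ≠ dst → r ≠ b → τ r = σ r) (fun _ h => h.1)
    (by
      rintro j τ ⟨h1, h2, h3, h4⟩
      refine ⟨by omega, _, .seq (.dec _ _) (.seq (.inc _ _) (.inc _ _)), ?_, ?_, ?_, ?_⟩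
      · simp [hsd, hsb, h1]
      · simp [hsd.symm, hdb]
        omega
      · simp [hsb.symm, hdb.symm]
        omega
      · intro r hr1 hr2 hr3
        simp [hr1, hr2, hr3, h4 r hr1 hr2 hr3])
    (j := σ src) (σ := Function.update (Function.update σ dst 0) b 0)
    (by
      refine ⟨by simp [hsd, hsb], by simp [hdb], by simp, fun r _ hr2 hr3 => by simp [hr2, hr3]⟩)
  obtain ⟨ρ, hρ, hρb, hρs, hρd, hρo⟩ := exec_loop (r := b) (P := .seq (.dec b) (.inc src))
    (fun j ρ => ρ b = j ∧ ρ src + j = σ src ∧ ρ dst = σ src ∧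
      ∀ r, r ≠ src → r ≠ dst → r ≠ b → ρ r = σ r) (fun _ h => h.1)
    (by
      rintro j τ ⟨h1, h2, h3, h4⟩
      refine ⟨by omega, _, .seq (.dec _ _) (.inc _ _), ?_, ?_, ?_, ?_⟩
      · simp [hsb.symm, h1]
      · simp [hsb]
        omega
      · simp [hsd.symm, hdb, h3]
      · intro r hr1 hr2 hr3
        simp [hr1, hr3, h4 r hr1 hr2 hr3])
    (j := σ src) (σ := τ) ⟨by omega, by omega, by omega, hτo⟩
  refine ⟨ρ, .seq (exec_clear _ _) (.seq (exec_clear _ _) (.seq hτ hρ)), hρd, fun r hr hrd => ?_⟩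
  by_cases hrs : r = src
  · subst hrs
    omega
  · exact hρo r hrs hrd hr.ne

/-- For all choices of the input registers, the output register and the bound `b` of the registers
in use, there is a program that computes `f` and changes no other register below `b`. -/
def Computes {n : ℕ} (f : List.Vector ℕ n →. ℕ) : Prop :=
  ∀ (ins : Fin n → ℕ) (out b : ℕ), (∀ i, ins i < b) → (∀ i, ins i ≠ out) → out < b →
    ∃ P, ∀ σ (v : List.Vector ℕ n) y, (∀ i, σ (ins i) = v.get i) → y ∈ f v → Assigns b P σ out y

theorem computes_zero : Computes ((fun _ => 0 : List.Vector ℕ 0 → ℕ) : List.Vector ℕ 0 →. ℕ) := by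
  intro ins out b _ _ _
  refine ⟨.clear out, fun σ v y _ hy => ⟨_, exec_clear out σ, ?_, fun r _ hr => ?_⟩⟩
  · rw [Part.mem_some_iff.1 hy]
    simp
  · simp [hr]

theorem computes_get {n : ℕ} (i : Fin n) :
    Computes ((fun v => v.get i : List.Vector ℕ n → ℕ) : List.Vector ℕ n →. ℕ) := by
  intro ins out b hins hne hout
  refine ⟨.copy (ins i) out b, fun σ v y hv hy => ?_⟩
  rw [Part.mem_some_iff.1 hy]
  change Assigns b _ σ out (v.get i)
  rw [← hv i]
  exact assigns_copy (hins i) hout (hne i) σ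

theorem computes_succ :
    Computes ((fun v => v.head.succ : List.Vector ℕ 1 → ℕ) : List.Vector ℕ 1 →. ℕ) := by
  intro ins out b hins hne hout
  refine ⟨.seq (.copy (ins 0) out b) (.inc out), fun σ v y hv hy => ?_⟩
  rw [Part.mem_some_iff.1 hy]
  change Assigns b _ σ out (v.head + 1)
  rw [← List.Vector.get_zero, ← hv 0]
  obtain ⟨τ, hτ, ho, hr⟩ := assigns_copy (hins 0) hout (hne 0) σ
  refine ⟨_, .seq hτ (.inc _ _), by simp [ho], fun r hrb hro => ?_⟩
  rw [Function.update_of_ne hro, hr r hrb hro]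

/-- Computing several functions one after the other. -/
theorem Computes.exists_prog_list {m n : ℕ} {g : Fin n → List.Vector ℕ m →. ℕ}
    (hg : ∀ i, Computes (g i)) {ins : Fin m → ℕ} {b : ℕ} (hins : ∀ i, ins i < b) (l : ℕ)
    (hl : l ≤ n) :
    ∃ P, ∀ σ (v : List.Vector ℕ m) (w : List.Vector ℕ n), (∀ i, σ (ins i) = v.get i) →
      (∀ i, w.get i ∈ g i v) →
      ∃ τ, Exec P σ τ ∧ (∀ i : Fin n, i < l → τ (b + i) = w.get i) ∧ ∀ r < b, τ r = σ r := by
  induction l with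
  | zero =>
    -- With nothing to compute, `clear b` serves as an empty program, since register `b` is not
    -- protected.
    refine ⟨.clear b, fun σ v w _ _ => ⟨_, exec_clear b σ, fun i hi => by omega, fun r hr => ?_⟩⟩
    rw [Function.update_of_ne hr.ne]
  | succ l ih =>
    obtain ⟨P, hP⟩ := ih (by omega)
    obtain ⟨G, hG⟩ := hg ⟨l, hl⟩ ins (b + l) (b + n) (fun i => by have := hins i; omega)
      (fun i => by have := hins i; omega) (by omega)
    refine ⟨.seq P G, fun σ v w hv hw => ?_⟩
    obtain ⟨τ, hτ, hτw, hτσ⟩ := hP σ v w hv hw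
    obtain ⟨ρ, hρ, hρl, hρτ⟩ := hG τ v _ (fun i => by rw [hτσ _ (hins i), hv]) (hw ⟨l, hl⟩)
    refine ⟨ρ, .seq hτ hρ, fun i hi => ?_, fun r hr => ?_⟩
    · by_cases hil : (i : ℕ) = l
      · obtain rfl : i = ⟨l, hl⟩ := Fin.ext hil
        exact hρl
      · rw [hρτ _ (by omega) (by omega), hτw i (by omega)]
    · rw [hρτ _ (by omega) (by omega), hτσ r hr]

/-- The intermediate values are kept in the fresh registers `b, …, b + n - 1`, which are then the
inputs of `f`. Only arguments where `h` is defined matter, so one implication in `hh` suffices. -/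
theorem Computes.comp {m n : ℕ} {f : List.Vector ℕ n →. ℕ} {g : Fin n → List.Vector ℕ m →. ℕ}
    {h : List.Vector ℕ m →. ℕ} (hf : Computes f) (hg : ∀ i, Computes (g i))
    (hh : ∀ v y, y ∈ h v → ∃ w : List.Vector ℕ n, (∀ i, w.get i ∈ g i v) ∧ y ∈ f w) :
    Computes h := by
  intro ins out b hins hne hout
  obtain ⟨P, hP⟩ := Computes.exists_prog_list hg hins n le_rfl
  obtain ⟨F, hF⟩ := hf (fun i => b + i) out (b + n) (fun i => by omega) (fun i => by omega)
    (by omega)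
  refine ⟨.seq P F, fun σ v y hv hy => ?_⟩
  obtain ⟨w, hw, hy⟩ := hh v y hy
  obtain ⟨τ, hτ, hτw, hτσ⟩ := hP σ v w hv hw
  obtain ⟨ρ, hρ, hρo, hρτ⟩ := hF τ w y (fun i => hτw i i.2) hy
  exact ⟨ρ, .seq hτ hρ, hρo, fun r hr hro => by rw [hρτ r (by omega) hro, hτσ r hr]⟩

/-- Register `b` counts the remaining rounds, `b + 1` holds the recursion index, `b + 2` the current
value and `b + 3` the next one; registers from `b + 4` on are scratch. -/
theorem Computes.prec {n : ℕ} {f : List.Vector ℕ n → ℕ} {g : List.Vector ℕ (n + 2) → ℕ}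
    (hf : Computes (f : List.Vector ℕ n →. ℕ)) (hg : Computes (g : List.Vector ℕ (n + 2) →. ℕ)) :
    Computes ((fun v => v.head.rec (f v.tail) fun y IH => g (y ::ᵥ IH ::ᵥ v.tail) :
      List.Vector ℕ (n + 1) → ℕ) : List.Vector ℕ (n + 1) →. ℕ) := by
  intro ins out b hins hne hout
  obtain ⟨F, hF⟩ := hf (fun i => ins i.succ) (b + 2) (b + 4)
    (fun i => by have := hins i.succ; omega) (fun i => by have := hins i.succ; omega) (by omega)
  obtain ⟨G, hG⟩ := hg (Fin.cons (b + 1) (Fin.cons (b + 2) fun i => ins i.succ)) (b + 3) (b + 4)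
    (by
      refine Fin.cases (by simp) (Fin.cases (by simp) fun i => ?_)
      have := hins i.succ
      simp only [Fin.cons_succ]
      omega)
    (by
      refine Fin.cases (by simp) (Fin.cases (by simp) fun i => ?_)
      have := hins i.succ
      simp only [Fin.cons_succ]
      omega)
    (by omega)
  refine ⟨.seq (.copy (ins 0) b (b + 4)) (.seq F (.seq (.clear (b + 1)) (.seq
    (.loop b (.seq (.dec b) (.seq G (.seq (.copy (b + 3) (b + 2) (b + 4)) (.inc (b + 1))))))
    (.copy (b + 2) out (b + 4))))), fun σ v y hv hy => ?_⟩
  rw [Part.mem_some_iff.1 hy]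
  have h0 := hins 0
  obtain ⟨σ₁, e₁, o₁, k₁⟩ := assigns_copy (src := ins 0) (dst := b) (b := b + 4) (by omega)
    (by omega) (by omega) σ
  obtain ⟨σ₂, e₂, o₂, k₂⟩ := hF σ₁ v.tail _ (fun i => by
    have := hins i.succ
    rw [k₁ _ (by omega) (by omega), hv, List.Vector.get_tail_succ]) (Part.mem_some _)
  obtain ⟨τ, hτ, hτb, i, hi, hτi, hτa, hτσ⟩ := exec_loop (r := b)
    (P := .seq (.dec b) (.seq G (.seq (.copy (b + 3) (b + 2) (b + 4)) (.inc (b + 1)))))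
    (fun j τ => τ b = j ∧ ∃ i, i + j = v.head ∧ τ (b + 1) = i ∧
      τ (b + 2) = i.rec (f v.tail) (fun y IH => g (y ::ᵥ IH ::ᵥ v.tail)) ∧
      ∀ r < b, τ r = σ r) (fun _ h => h.1)
    (by
      rintro j τ ⟨hb, i, hi, hτi, hτa, hτσ⟩
      obtain ⟨τ₁, E₁, O₁, K₁⟩ := hG (Function.update τ b (τ b - 1))
        (i ::ᵥ (i.rec (f v.tail) (fun y IH => g (y ::ᵥ IH ::ᵥ v.tail))) ::ᵥ v.tail) _
        (by
          refine Fin.cases (by simp [hτi]) (Fin.cases ?_ fun i => ?_)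
          · rw [Fin.cons_succ, Fin.cons_zero, List.Vector.get_cons_succ,
              List.Vector.get_cons_zero, Function.update_of_ne (by omega), hτa]
          have := hins i.succ
          simp only [Fin.cons_succ, List.Vector.get_cons_succ]
          rw [Function.update_of_ne (by omega), hτσ _ this, hv, List.Vector.get_tail_succ])
        (Part.mem_some _)
      obtain ⟨τ₂, E₂, O₂, K₂⟩ := assigns_copy (src := b + 3) (dst := b + 2) (b := b + 4)
        (by omega) (by omega) (by omega) τ₁
      refine ⟨by omega, _, .seq (.dec _ _) (.seq E₁ (.seq E₂ (.inc _ _))), ?_, i + 1, by omega,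
        ?_, ?_, fun r hr => ?_⟩
      · rw [Function.update_of_ne (by omega), K₂ _ (by omega) (by omega),
          K₁ _ (by omega) (by omega), Function.update_self, hb]
        rfl
      · rw [Function.update_self, K₂ _ (by omega) (by omega), K₁ _ (by omega) (by omega),
          Function.update_of_ne (by omega), hτi]
      · rw [Function.update_of_ne (by omega), O₂, O₁]
      · rw [Function.update_of_ne (by omega), K₂ _ (by omega) (by omega),
          K₁ _ (by omega) (by omega), Function.update_of_ne (by omega), hτσ r hr])
    (j := v.head) (σ := Function.update σ₂ (b + 1) 0)
    (by
      refine ⟨?_, 0, by omega, by simp, ?_, fun r hr => ?_⟩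
      · rw [Function.update_of_ne (by omega), k₂ _ (by omega) (by omega), o₁, hv,
          List.Vector.get_zero]
      · rw [Function.update_of_ne (by omega), o₂]
        rfl
      · rw [Function.update_of_ne (by omega), k₂ _ (by omega) (by omega),
          k₁ _ (by omega) (by omega)])
  obtain ⟨ρ, hρ, hρo, hρτ⟩ := assigns_copy (src := b + 2) (dst := out) (b := b + 4) (by omega)
    (by omega) (by omega) τ
  obtain rfl : i = v.head := by omega
  refine ⟨ρ, .seq e₁ (.seq e₂ (.seq (exec_clear _ _) (.seq hτ hρ))), by rw [hρo, hτa],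
    fun r hr hro => ?_⟩
  rw [hρτ r (by omega) hro, hτσ r hr]

/-- Register `b` holds the candidate and `b + 1` the value of `f` there, which is the loop
condition. If the search succeeds with `y`, candidate `i` has `y - i` rounds left; each round ends
because `f` is total. -/
theorem Computes.rfind {n : ℕ} {f : List.Vector ℕ (n + 1) → ℕ}
    (hf : Computes (f : List.Vector ℕ (n + 1) →. ℕ)) :
    Computes fun v : List.Vector ℕ n => Nat.rfind fun i => some (decide (f (i ::ᵥ v) = 0)) := by
  intro ins out b hins hne hout
  obtain ⟨F, hF⟩ := hf (Fin.cons b ins) (b + 1) (b + 2)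
    (Fin.cases (by simp) fun i => by have := hins i; simp only [Fin.cons_succ]; omega)
    (Fin.cases (by simp) fun i => by have := hins i; simp only [Fin.cons_succ]; omega)
    (by omega)
  refine ⟨.seq (.clear b) (.seq F (.seq (.loop (b + 1) (.seq (.inc b) F))
    (.copy b out (b + 2)))), fun σ v y hv hy => ?_⟩
  obtain ⟨hy0, hlt⟩ := Nat.mem_rfind.1 hy
  replace hy0 : f (y ::ᵥ v) = 0 := by simpa using hy0
  replace hlt : ∀ i < y, f (i ::ᵥ v) ≠ 0 := fun i hi => by simpa using hlt hi
  have step : ∀ (τ : ℕ → ℕ) i, τ b = i → (∀ r < b, τ r = σ r) →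
      ∃ ρ, Exec F τ ρ ∧ ρ b = i ∧ ρ (b + 1) = f (i ::ᵥ v) ∧ ∀ r < b, ρ r = σ r := by
    intro τ i hi hτσ
    obtain ⟨ρ, E, O, K⟩ := hF τ (i ::ᵥ v) _
      (Fin.cases (by simp [hi]) fun i => by simp [hτσ _ (hins i), hv]) (Part.mem_some _)
    refine ⟨ρ, E, ?_, O, fun r hr => ?_⟩
    · rw [K _ (by omega) (by omega), hi]
    · rw [K _ (by omega) (by omega), hτσ r hr]
  obtain ⟨σ₁, E₁, B₁, F₁, K₁⟩ := step (Function.update σ b 0) 0 (by simp)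
    (fun r hr => by rw [Function.update_of_ne hr.ne])
  obtain ⟨τ, hτ, i, hi, hτb, -, hτσ⟩ := exec_loop (r := b + 1) (P := .seq (.inc b) F)
    (fun j τ => ∃ i, i + j = y ∧ τ b = i ∧ τ (b + 1) = f (i ::ᵥ v) ∧ ∀ r < b, τ r = σ r)
    (by
      rintro τ ⟨i, hi, -, hτ, -⟩
      obtain rfl : i = y := by omega
      rw [hτ, hy0])
    (by
      rintro j τ ⟨i, hi, hτb, hτf, hτσ⟩
      obtain ⟨ρ, E, B, R, K⟩ := step (Function.update τ b (τ b + 1)) (i + 1) (by simp [hτb])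
        (fun r hr => by rw [Function.update_of_ne hr.ne, hτσ r hr])
      refine ⟨by rw [hτf]; exact hlt i (by omega), ρ, .seq (.inc _ _) E, i + 1, by omega, B, R, K⟩)
    (j := y) (σ := σ₁) ⟨0, by omega, B₁, F₁, K₁⟩
  obtain rfl : i = y := by omega
  obtain ⟨ρ, hρ, hρo, hρτ⟩ := assigns_copy (src := b) (dst := out) (b := b + 2) (by omega)
    (by omega) (by omega) τ
  refine ⟨ρ, .seq (exec_clear _ _) (.seq E₁ (.seq hτ hρ)), by rw [hρo, hτb], fun r hr hro => ?_⟩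
  rw [hρτ r (by omega) hro, hτσ r hr]

theorem computes_of_primrec' {n : ℕ} {f : List.Vector ℕ n → ℕ} (hf : Nat.Primrec' f) :
    Computes (f : List.Vector ℕ n →. ℕ) := by
  induction hf with
  | zero => exact computes_zero
  | succ => exact computes_succ
  | get i => exact computes_get i
  | @comp m n f g _ _ ihf ihg =>
    refine Computes.comp ihf ihg fun v y hy => ⟨List.Vector.ofFn fun i => g i v, fun i => ?_, hy⟩
    rw [List.Vector.get_ofFn]
    exact Part.mem_some _
  | prec _ _ ihf ihg => exact Computes.prec ihf ihg

theorem get_mem_of_mem_mOfFn {n : ℕ} {α : Type} {f : Fin n → Part α} {w : List.Vector α n}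
    (hw : w ∈ List.Vector.mOfFn f) (i : Fin n) : w.get i ∈ f i := by
  induction n with
  | zero => exact i.elim0
  | succ n ih =>
    simp only [List.Vector.mOfFn, Part.bind_eq_bind, Part.mem_bind_iff, Part.pure_eq_some,
      Part.mem_some_iff] at hw
    obtain ⟨a, ha, v, hv, rfl⟩ := hw
    refine Fin.cases (by simpa using ha) (fun i => ?_) i
    simpa using ih hv i

theorem computes_of_partrec' {n : ℕ} {f : List.Vector ℕ n →. ℕ} (hf : Nat.Partrec' f) :
    Computes f := by
  induction hf with
  | prim hf => exact computes_of_primrec' hf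
  | comp g _ _ ihf ihg =>
    refine Computes.comp ihf ihg fun v y hy => ?_
    obtain ⟨w, hw, hy⟩ := Part.mem_bind_iff.1 hy
    exact ⟨w, get_mem_of_mem_mOfFn hw, hy⟩
  | rfind _ ih => exact Computes.rfind ih

theorem exists_prog_of_computable {f : ℕ → ℕ} (hf : Computable f) :
    ∃ P : Prog, ∀ x, ∃ τ, Exec P (Function.update (fun _ => 0) 0 x) τ ∧ τ 1 = f x := by
  obtain ⟨P, hP⟩ := computes_of_partrec' (Nat.Partrec'.part_iff₁.2 hf) (fun _ => 0) 1 2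
    (by simp) (by simp) (by simp)
  refine ⟨P, fun x => ?_⟩
  obtain ⟨τ, hτ, h1, -⟩ := hP (Function.update (fun _ => 0) 0 x) (x ::ᵥ .nil) (f x)
    (by intro i; simp [Subsingleton.elim i 0]) (Part.mem_some _)
  exact ⟨τ, hτ, h1⟩

/-! ### Busy beavers outgrow computable functions -/

/-- Incrementing the register `0` exactly `x` times, and then running `P`. -/
def Prog.incs (x : ℕ) (P : Prog) : Prog := (Prog.seq (.inc 0))^[x] P

theorem exec_incs {x : ℕ} {P : Prog} {σ τ : ℕ → ℕ}
    (h : Exec P (Function.update σ 0 (σ 0 + x)) τ) : Exec (P.incs x) σ τ := by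
  induction x generalizing σ with
  | zero => simpa [Prog.incs] using h
  | succ x ih =>
    rw [Prog.incs, Function.iterate_succ_apply']
    refine .seq (.inc 0 σ) (ih ?_)
    rw [Function.update_self, Function.update_idem, Nat.add_assoc, Nat.add_comm 1 x]
    exact h

theorem BBMachine.finite_ones {n : ℕ} {B : BBMachine n} {t : ℕ} {c : BBConfig n}
    (hc : runFor B.step t B.init = some c) : {i | c.tape i = true}.Finite := by
  obtain ⟨v, hv⟩ := BBMachine.exists_visited t c hc
  refine (Set.finite_Iio v).subset fun i hi => ?_
  by_contra hlt
  have h1 : c.tape i = true := hi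
  rw [hv.blank i (not_lt.1 hlt)] at h1
  exact absurd h1 (by simp)

namespace Frag

/-- Each increment is a separate fragment of the same size, so hard-wiring the input `x` costs
linearly many states. -/
theorem exists_implements_incs {k : ℕ} {F : Frag} {P : Prog} [NeZero k] (hk : 1 < k)
    (hF : Implements k F P) (x : ℕ) :
    ∃ G, Implements k G (P.incs x) ∧
      Nat.card G.Q = Nat.card (inc k 0).Q * x + Nat.card F.Q := by
  induction x with
  | zero => exact ⟨F, hF, by simp⟩
  | succ x ih =>
    obtain ⟨G, hG, hcard⟩ := ih
    refine ⟨(inc k 0).seq G, ?_, ?_⟩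
    · rw [Prog.incs, Function.iterate_succ_apply']
      exact implements_seq (implements_inc (by omega)) hG
    · rw [card_seq, hcard]
      ring

/-- The busy beaver candidate that moves to the second cell, runs `F` and halts at its exit. -/
def toBB (F : Frag) {n : ℕ} (e : Option (Option F.Q) ≃ Fin n) : BBMachine n where
  start := e none
  δ i b :=
    match e.symm i with
    | none => some (e (some (some F.start)), false, Dir.right)
    | some none => none
    | some (some q) => some (e (some (F.δ q b).1), (F.δ q b).2)

/-- Configurations of `F` as configurations of `F.toBB e`. -/
def toBBConfig (F : Frag) {n : ℕ} (e : Option (Option F.Q) ≃ Fin n) (c : F.Cfg) : BBConfig n :=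
  ⟨e (some c.1), c.2.1, c.2.2⟩

theorem toBB_step (F : Frag) {n : ℕ} (e : Option (Option F.Q) ≃ Fin n) {c d : F.Cfg}
    (h : F.Step c d) : (F.toBB e).step (F.toBBConfig e c) = some (F.toBBConfig e d) := by
  rcases h with ⟨hδ⟩ | ⟨hδ⟩ <;>
    simp [BBMachine.step, toBBConfig, toBB, hδ]

theorem toBB_haltsWithOnes (F : Frag) {n : ℕ} (e : Option (Option F.Q) ≃ Fin n) {p : ℕ}
    {T : ℕ → Bool} (h : F.Steps (some F.start, 1, fun _ => false) (none, p, T)) :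
    (F.toBB e).HaltsWithOnes {i | T i = true}.ncard ∧ {i | T i = true}.Finite := by
  have hrun : Relation.ReflTransGen (fun a b => (F.toBB e).step a = some b)
      (F.toBBConfig e (some F.start, 1, fun _ => false)) (F.toBBConfig e (none, p, T)) :=
    Relation.ReflTransGen.lift (p := fun a b => (F.toBB e).step a = some b)
      (F.toBBConfig e) (fun _ _ => F.toBB_step e) _ _ h
  have hstart : (F.toBB e).step (F.toBB e).init
      = some (F.toBBConfig e (some F.start, 1, fun _ => false)) := by
    simp [BBMachine.step, BBMachine.init, toBBConfig, toBB]
  obtain ⟨t, ht⟩ := exists_runFor_of_reflTransGen (hrun.head hstart)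
  exact ⟨⟨t, _, ht, by simp [toBBConfig, toBB], rfl⟩, BBMachine.finite_ones ht⟩

/-- The unary track of a register alone contributes its value; marks and other registers can only
add ones. -/
theorem le_ncard_ones {k r m : ℕ} {σ : ℕ → ℕ} (hr : r + 1 < k)
    (hfin : {i | enc k σ m i = true}.Finite) : σ r ≤ {i | enc k σ m i = true}.ncard := by
  have hinj : Function.Injective fun j => k * j + (r + 1) := by
    intro i j hij
    have hij : k * i + (r + 1) = k * j + (r + 1) := hij
    exact Nat.eq_of_mul_eq_mul_left (by omega : 0 < k) (by omega)
  have hsub : ((Finset.range (σ r)).image fun j => k * j + (r + 1) : Set ℕ)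
      ⊆ {i | enc k σ m i = true} := by
    intro i hi
    simp only [Finset.coe_image, Finset.coe_range, Set.mem_image, Set.mem_Iio] at hi
    obtain ⟨j, hj, rfl⟩ := hi
    change enc k σ m _ = true
    rw [enc_reg (block_mod hr), block_div hr, decide_eq_true hj]
  have := Set.ncard_le_ncard hsub hfin
  rwa [Set.ncard_coe_finset, Finset.card_image_of_injective _ hinj, Finset.card_range] at this

end Frag

theorem exists_haltsWithOnes_of_computable {f : ℕ → ℕ} (hf : Computable f) :
    ∃ a c : ℕ, ∀ x, ∃ n, 0 < n ∧ n ≤ a * x + c ∧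
      ∃ (B : BBMachine n) (k : ℕ), B.HaltsWithOnes k ∧ f x ≤ k := by
  obtain ⟨P, hP⟩ := exists_prog_of_computable hf
  obtain ⟨b, hb⟩ := P.exists_below
  -- The tracks `b + 3` in number always include those of the input register `0` and the output
  -- register `1`, even if `b` is small.
  obtain ⟨F, hF⟩ := Frag.exists_implements (k := b + 3) P (hb.mono (by omega))
  refine ⟨Nat.card (Frag.inc (b + 3) 0).Q, Nat.card F.Q + 2, fun x => ?_⟩
  obtain ⟨G, hG, hcard⟩ := Frag.exists_implements_incs (k := b + 3) (by omega) hF x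
  obtain ⟨τ, hτ, h1⟩ := hP x
  obtain ⟨m, hm⟩ := hG (fun _ => 0) τ (exec_incs (by simpa using hτ)) 0
  have henc : Frag.enc (b + 3) (fun _ => 0) 0 = fun _ => false := by
    funext p
    unfold Frag.enc
    split_ifs
    · exact decide_eq_false (by omega)
    · simp
  rw [henc] at hm
  -- The two extra states are the exit and the initial state, which moves to cell `1`, where
  -- fragments start.
  have hQ : Nat.card (Option (Option G.Q)) = Nat.card G.Q + 2 := by
    rw [Finite.card_option, Finite.card_option]
  let e := Finite.equivFin (Option (Option G.Q))
  obtain ⟨hh, hfin⟩ := G.toBB_haltsWithOnes e hm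
  refine ⟨_, Nat.card_pos, by omega, G.toBB e, _, hh, ?_⟩
  rw [← h1]
  exact Frag.le_ncard_ones (by omega) hfin

/-! ### Unary singletons and automata -/

open scoped Computability in
-- Otherwise the word could be pumped down to a shorter accepted one. The exponential comes from the
-- pumping constant of the subset automaton and is harmless here.
theorem lt_two_pow_card_of_accepts_singleton {S : Type} [Finite S] {N : NFA Unit S} {m : ℕ}
    (h : N.accepts = {List.replicate m ()}) : m < 2 ^ Nat.card S := by
  classical
  have := Fintype.ofFinite S
  by_contra hlt
  have hmem : List.replicate m () ∈ N.accepts := by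
    rw [h]
    rfl
  obtain ⟨a, b, c, habc, -, hb, hsub⟩ := N.pumping_lemma hmem (by
    rw [List.length_replicate, Fintype.card_set, ← Nat.card_eq_fintype_card]
    exact not_lt.1 hlt)
  have hac : a ++ c ∈ ({a} * {b}∗ * {c} : Language Unit) := by
    refine Language.append_mem_mul ?_ rfl
    have := Language.append_mem_mul (Set.mem_singleton a) (Language.nil_mem_kstar {b})
    rwa [List.append_nil] at this
  have hac' := hsub hac
  rw [h] at hac'
  have h1 : a ++ c = List.replicate m () := hac'
  have h2 := congrArg List.length (h1.trans habc)
  simp only [List.length_append] at h2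
  exact hb (List.length_eq_zero_iff.1 (by omega))

/-! ### The sizes of the simulators -/

/-- A bound on the size of the simulator of a machine with `n` states. -/
noncomputable def simSizeBound (n : ℕ) : ℕ :=
  (n + Nat.card HPhase) * Nat.card HSym * (2 * ((n + Nat.card HPhase) * Nat.card HSym) + 1)
    + (n + Nat.card HPhase) + (n + Nat.card HPhase)

theorem clog_two_le_self (m : ℕ) : Nat.clog 2 m ≤ m :=
  Nat.clog_le_of_le_pow Nat.lt_two_pow_self.le

/-- Replacing the logarithms by their arguments is crude but leaves a monotone polynomial, plainly
primitive recursive. -/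
theorem size_simulator_le {n : ℕ} (B : BBMachine n) : (simulator B).size ≤ simSizeBound n := by
  have hΓ : Nat.card (simulator B).Γ = Nat.card HSym := rfl
  unfold DTM.size simSizeBound
  rw [card_simulator_Q, hΓ]
  gcongr <;> exact clog_two_le_self _

theorem simSizeBound_mono : Monotone simSizeBound := by
  intro m n h
  unfold simSizeBound
  gcongr

theorem primrec_simSizeBound : Primrec simSizeBound := by
  have h1 : Primrec fun n => n + Nat.card HPhase := Primrec.nat_add.comp .id (.const _)
  have h2 : Primrec fun n => (n + Nat.card HPhase) * Nat.card HSym :=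
    Primrec.nat_mul.comp h1 (.const _)
  exact Primrec.nat_add.comp (Primrec.nat_add.comp (Primrec.nat_mul.comp h2
    (Primrec.succ.comp (Primrec.nat_mul.comp (.const 2) h2))) h1) h1

theorem primrec_two_pow : Primrec fun n : ℕ => 2 ^ n := by
  refine (Primrec.nat_rec₁ (f := fun _ y => y * 2) 1
    (Primrec.nat_mul.comp Primrec.snd (.const 2))).of_eq fun n => ?_
  induction n with
  | zero => rfl
  | succ n ih => rw [pow_succ, ← ih]

/-- Partial sums dominate all earlier values, which replaces monotonicity of `f`. -/
theorem computable_sum_range {f : ℕ → ℕ} (hf : Computable f) :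
    Computable fun n => ∑ i ∈ Finset.range n, f i := by
  have h : Computable₂ fun (_ : ℕ) (p : ℕ × ℕ) => p.2 + f p.1 :=
    Primrec.nat_add.to_comp.comp (Computable.snd.comp .snd)
      (hf.comp (Computable.fst.comp .snd))
  refine (Computable.nat_rec .id (.const 0) h).of_eq fun n => ?_
  induction n with
  | zero => rfl
  | succ n ih => rw [Finset.sum_range_succ, ← ih]; rfl

/-- The busy beaver has at least `g x` ones, hence at least that much space, while the space is
below `2 ^ Nat.card S`. Comparing exponents bounds `Nat.card S` below by a sum that contains the
term `f (simulator B).size`. -/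
theorem exists_lt_card_of_computable {f : ℕ → ℕ} (hf : Computable f) :
    ∃ n : ℕ, 0 < n ∧ ∀ B : BBMachine n, B.IsBusyBeaver →
      ∀ (S : Type) [Finite S] (N : NFA Unit S), N.accepts = (simulator B).language →
        f (simulator B).size < Nat.card S := by
  let g : ℕ → ℕ := fun x => 2 ^ ∑ i ∈ Finset.range (simSizeBound (x * x) + 1), f i
  have hg : Computable g :=
    primrec_two_pow.to_comp.comp ((computable_sum_range hf).comp
      (Primrec.succ.comp (primrec_simSizeBound.comp
        (Primrec.nat_mul.comp .id .id))).to_comp)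
  obtain ⟨a, c, h⟩ := exists_haltsWithOnes_of_computable hg
  -- For `x = a + c + 1` one has `a * x + c ≤ x * x`, so `n` lies in the range for which `g` was
  -- built, although `a` and `c` depend on `g`.
  obtain ⟨n, hn, hle, B', k', hB', hk'⟩ := h (a + c + 1)
  refine ⟨n, hn, fun B hB S _ N hN => ?_⟩
  obtain ⟨k, hk, hmax⟩ := hB
  rw [simulator_language hk] at hN
  have h1 := lt_two_pow_card_of_accepts_singleton hN
  have h2 : g (a + c + 1) < 2 ^ Nat.card S :=
    (hk'.trans ((hmax B' k' hB').trans hk.le_space)).trans_lt h1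
  have h3 := (Nat.pow_lt_pow_iff_right (by norm_num)).1 h2
  refine lt_of_le_of_lt ?_ h3
  refine Finset.single_le_sum (fun _ _ => Nat.zero_le _) (Finset.mem_range.2 ?_)
  refine Nat.lt_succ_of_le ((size_simulator_le B).trans (simSizeBound_mono (hle.trans ?_)))
  nlinarith

/-! ### From state counts to description sizes -/

theorem card_le_nfaSize {A S : Type} (N : NFA A S) : Nat.card S ≤ nfaSize N := by
  unfold nfaSize
  omega

theorem card_le_dfaSize {A S : Type} (N : NFA A S) : Nat.card S ≤ dfaSize N := by
  unfold dfaSize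
  omega

end HennieTradeoff

theorem mainTheorem6 :
    -- no recursive bound for the conversion of Hennie machines into NFAs
    (¬ ∃ f : ℕ → ℕ, Computable f ∧
      ∀ (A : Type) [Finite A] (H : HennieTradeoff.EndMarkedDTM A), H.IsHennie →
        ∃ (S : Type) (_ : Finite S) (N : NFA A S),
          N.accepts = H.language ∧ HennieTradeoff.nfaSize N ≤ f H.size) ∧
    -- no recursive bound for the conversion of Hennie machines into DFAs
    (¬ ∃ f : ℕ → ℕ, Computable f ∧
      ∀ (A : Type) [Finite A] (H : HennieTradeoff.EndMarkedDTM A), H.IsHennie →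
        ∃ (S : Type) (_ : Finite S) (N : NFA A S), HennieTradeoff.IsDeterministic N ∧
          N.accepts = H.language ∧ HennieTradeoff.dfaSize N ≤ f H.size) ∧
    -- the witnesses
    (∀ n : ℕ, 0 < n → ∃ B : HennieTradeoff.BBMachine n, B.IsBusyBeaver) ∧
    ∃ (C D : ℕ) (H : (n : ℕ) → HennieTradeoff.BBMachine n → HennieTradeoff.EndMarkedDTM Unit),
      (∀ (n : ℕ) (B : HennieTradeoff.BBMachine n), B.IsBusyBeaver →
        (H n B).IsHennie ∧
        Nat.card (H n B).Q ≤ C * n ∧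
        Nat.card (H n B).Γ ≤ D ∧
        (H n B).language = {List.replicate B.space ()}) ∧
      (∀ f : ℕ → ℕ, Computable f →
        ∃ n : ℕ, 0 < n ∧ ∀ B : HennieTradeoff.BBMachine n, B.IsBusyBeaver →
          ∀ (S : Type) [Finite S] (N : NFA Unit S), N.accepts = (H n B).language →
            f (H n B).size < Nat.card S) := by
  refine ⟨?_, ?_, fun n hn => HennieTradeoff.BBMachine.exists_isBusyBeaver hn,
    1 + Nat.card HennieTradeoff.HPhase, Nat.card HennieTradeoff.HSym,
    fun n B => HennieTradeoff.simulator B, ?_,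
    fun f hf => HennieTradeoff.exists_lt_card_of_computable hf⟩
  · rintro ⟨f, hf, h⟩
    obtain ⟨n, hn, hlt⟩ := HennieTradeoff.exists_lt_card_of_computable hf
    obtain ⟨B, hB⟩ := HennieTradeoff.BBMachine.exists_isBusyBeaver hn
    obtain ⟨k, hk, -⟩ := id hB
    obtain ⟨S, _, N, hN, hle⟩ :=
      h Unit (HennieTradeoff.simulator B) (HennieTradeoff.simulator_isHennie hk)
    have h1 := hlt B hB S N hN
    have h2 := HennieTradeoff.card_le_nfaSize N
    omega
  · rintro ⟨f, hf, h⟩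
    obtain ⟨n, hn, hlt⟩ := HennieTradeoff.exists_lt_card_of_computable hf
    obtain ⟨B, hB⟩ := HennieTradeoff.BBMachine.exists_isBusyBeaver hn
    obtain ⟨k, hk, -⟩ := id hB
    obtain ⟨S, _, N, -, hN, hle⟩ :=
      h Unit (HennieTradeoff.simulator B) (HennieTradeoff.simulator_isHennie hk)
    have h1 := hlt B hB S N hN
    have h2 := HennieTradeoff.card_le_dfaSize N
    omega
  · rintro n B ⟨k, hk, -⟩
    refine ⟨HennieTradeoff.simulator_isHennie hk, ?_, le_rfl,
      HennieTradeoff.simulator_language hk⟩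
    rw [HennieTradeoff.card_simulator_Q, Nat.add_mul, Nat.one_mul]
    -- The constant number of phases is absorbed into the factor because `n` is positive, as the
    -- start state of `B` shows.
    exact Nat.add_le_add_left (Nat.le_mul_of_pos_right _ (Fin.pos B.start)) _
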